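/- Setting. Let $(M,g)$ be a non-empty (pseudo-)Riemannian spin manifold of dimension $n\ge 1$, with Levi-Civita connection $\nabla$, and let $S$ be its spinor bundle, i.e. the bundle associated to the spin structure and a nonzero real or complex module of the Clifford algebra, with Clifford multiplication $\gamma$, $\gamma(X)\gamma(Y)+\gamma(Y)\gamma(X)=-2g(X,Y)$, and with the connection $\nabla$ induced by the Levi-Civita connection. Let $\gamma_{\mu_1\cdots\mu_k}=\gamma_{[\mu_1}\cdots\gamma_{\mu_k]}$. Let $C$ be a charge conjugation on $S$, i.e. a nondegenerate spin-invariant bilinear form such that $C_0=C$ and $C_1$ are each symmetric or skew symmetric, where $(C_k(\phi\otimes\psi))_{\mu_1\ldots\mu_k}=C(\phi,\gamma_{\mu_1\cdots\mu_k}\psi)$. Put $\Delta_k=1$ if $C_k$ is symmetric and $\Delta_k=-1$ otherwise. Let $$\tau_0=\begin{pmatrix}1&0\\0&1\end{pmatrix},\quad \tau_1=\begin{pmatrix}0&1\\1&0\end{pmatrix},\quad \tau_2=\begin{pmatrix}0&1\\-1&0\end{pmatrix},\quad \tau_3=\begin{pmatrix}1&0\\0&-1\end{pmatrix},$$ and define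 the signs $\varepsilon_j,\varepsilon_{ij}$ by $\tau_j^{T}=\varepsilon_j\tau_j$ and $\tau_i\tau_j=\varepsilon_{ij}\tau_j\tau_i$. Equip $S\oplus S$ with Clifford multiplication on both summands and with the bilinear form $C\otimes\tau_i$, $(C\otimes\tau_i)(\eta,\xi)=\sum_{a,b}(\tau_i)_{ab}\,C(\eta_a,\xi_b)$. For a connection $D$ on $S\oplus S$ let $D^C$ be the connection for which $D\otimes 1+1\otimes D^C$ makes $C\otimes\tau_i$ parallel, and let $(\hat D_X\gamma)(Y)\xi=D_X(\gamma(Y)\xi)-\gamma(\nabla_XY)\xi-\gamma(Y)D^C_X\xi$. The connection $D$ is called admissible if $D^C$ exists and $(\hat D_X\gamma)(Y)=-(\hat D_Y\gamma)(X)$ for all vector fields $X,Y$. Theorem. Let $i,j\in\{0,1,2,3\}$. (1) For all $k$ the map $C_k$ has the symmetry $\Delta_k$, that is, $C_k(\psi\otimes\phi)=\Delta_k\,C_k(\phi\otimes\psi)$. (2) Let $F$ be an $\ell$-form on $M$ which does not vanish identically (with values in the ground field of $S$), and let $$\mathcal A_\mu=\tfrac1{\ell!}F_{i_1\ldots i_\ell}\gamma^{i_1\ldots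 i_\ell}\gamma_\mu\otimes\tau_j .$$ Then the connection $\nabla+\mathcal A$ on $S\oplus S$ is admissible if and only if $$\Delta_\ell\,\Delta_1\,\varepsilon_j\,\varepsilon_{ij}=-1 .$$ More generally, if $D$ is any admissible connection on $S\oplus S$, then $D+\mathcal A$ is admissible if and only if this equation holds. (3) For $0\le\ell\le n$ the equation $\Delta_\ell\Delta_1\varepsilon_j\varepsilon_{ij}=-1$ holds if and only if $(\ell,i,j)$ is listed in the following table: $$\begin{array}{c|c|c} i & \ell \bmod 4 & j\\ \hline 0 & 1 \text{ or } 1-\Delta_0\Delta_1 & 2\\ 0 & 3 \text{ or } 1+\Delta_0\Delta_1 & 0,1,3\\ \hline 1 & 1 \text{ or } 1-\Delta_0\Delta_1 & 3\\ 1 & 3 \text{ or } 1+\Delta_0\Delta_1 & 0,1,2\\ \hline 2 & 1 \text{ or } 1-\Delta_0\Delta_1 & 1,2,3\\ 2 & 3 \text{ or } 1+\Delta_0\Delta_1 & 0\\ \hline 3 & 1 \text{ or } 1-\Delta_0\Delta_1 & 1\\ 3 & 3 \text{ or } 1+\Delta_0\Delta_1 & 0,2,3 \end{array}$$ -/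

import Mathlib

open Bundle Module
open scoped Manifold ContDiff

noncomputable section

namespace SpinorConnection

/-! ### The modified Pauli matrices and their signs -/

/-- The modified Pauli matrices `τ₀ = 1`, `τ₁ = σ₁`, `τ₂ = i σ₂`, `τ₃ = σ₃`. -/
def tau : Fin 4 → Matrix (Fin 2) (Fin 2) ℤ :=
  ![!![1, 0; 0, 1], !![0, 1; 1, 0], !![0, 1; -1, 0], !![1, 0; 0, -1]]

/-- The sign `ε_j`, the symmetry of `τ_j`. -/
def eps : Fin 4 → ℤ := ![1, 1, -1, 1]

/-- The sign `ε_{ij}` which appears when `τ_i` and `τ_j` are permuted. -/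
def epsComm : Fin 4 → Fin 4 → ℤ :=
  ![![1, 1, 1, 1], ![1, 1, -1, -1], ![1, -1, 1, -1], ![1, -1, -1, 1]]

theorem tau_transpose (j : Fin 4) : (tau j).transpose = eps j • tau j := by
  revert j; decide

theorem tau_mul_tau (i j : Fin 4) : tau i * tau j = epsComm i j • (tau j * tau i) := by
  revert i j; decide

/-- The rows of the left table, `ℓ mod 4 = 1`, and of the right table, `ℓ mod 4 = 1 - Δ₀Δ₁`:
the values of `j` for `i = 0, 1, 2, 3`. -/
def rowMinus : Fin 4 → Finset (Fin 4) := ![{2}, {3}, {1, 2, 3}, {1}]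

/-- The rows of the left table, `ℓ mod 4 = 3`, and of the right table, `ℓ mod 4 = 1 + Δ₀Δ₁`:
the values of `j` for `i = 0, 1, 2, 3`. -/
def rowPlus : Fin 4 → Finset (Fin 4) := ![{0, 1, 3}, {0, 1, 2}, {0}, {0, 2, 3}]

/-- The triple `(ℓ, i, j)` is listed in the table; `δ` stands for the product `Δ₀Δ₁`. -/
def InTable (δ : ℤ) (ℓ : ℕ) (i j : Fin 4) : Prop :=
  (((ℓ : ℤ) ≡ 1 [ZMOD 4] ∨ (ℓ : ℤ) ≡ 1 - δ [ZMOD 4]) ∧ j ∈ rowMinus i) ∨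
  (((ℓ : ℤ) ≡ 3 [ZMOD 4] ∨ (ℓ : ℤ) ≡ 1 + δ [ZMOD 4]) ∧ j ∈ rowPlus i)

/-! ### Algebra of gamma matrices -/

section Algebra

variable {𝕜 : Type*} [RCLike 𝕜] {T : Type*} [AddCommGroup T] [Module ℝ T]
  {W : Type*} [AddCommGroup W] [Module ℝ W] [Module 𝕜 W] [IsScalarTower ℝ 𝕜 W]

/-- The antisymmetrized product `γ_{v₁ ⋯ v_k} = γ_{[v₁} ⋯ γ_{v_k]}` (of total weight one). -/
def gammaAnti (γ : T →ₗ[ℝ] Module.End 𝕜 W) {k : ℕ} (v : Fin k → T) : Module.End 𝕜 W :=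
  ((Nat.factorial k : 𝕜)⁻¹) • ∑ s : Equiv.Perm (Fin k),
    (Equiv.Perm.sign s : ℤ) • (List.ofFn fun a => γ (v (s a))).prod

/-- The endomorphism `(1/ℓ!) F_{i₁ ⋯ i_ℓ} γ^{i₁ ⋯ i_ℓ}` of an alternating form `F`. Here `b` is a
basis, `F_{i₁ ⋯ i_ℓ}` are the components of `F` with respect to it, and the indices of the
`γ`-matrices are raised with the nondegenerate bilinear form `B`. -/
def formEnd [FiniteDimensional ℝ T] (γ : T →ₗ[ℝ] Module.End 𝕜 W)
    (B : LinearMap.BilinForm ℝ T) (hB : B.Nondegenerate) {ℓ : ℕ}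
    (F : T [⋀^Fin ℓ]→ₗ[ℝ] 𝕜) : Module.End 𝕜 W :=
  let b := Module.finBasis ℝ T
  ((Nat.factorial ℓ : 𝕜)⁻¹) • ∑ f : Fin ℓ → Fin (finrank ℝ T),
    F (fun a => b (f a)) • gammaAnti γ (fun a => B.dualBasis hB b (f a))

/-- The endomorphism `1 ⊗ m` of `W ⊕ W = W ⊗ 𝕜²`. -/
def twist (m : Matrix (Fin 2) (Fin 2) ℤ) : Module.End 𝕜 (W × W) :=
  LinearMap.prod
    (m 0 0 • LinearMap.fst 𝕜 W W + m 0 1 • LinearMap.snd 𝕜 W W)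
    (m 1 0 • LinearMap.fst 𝕜 W W + m 1 1 • LinearMap.snd 𝕜 W W)

/-- The endomorphism `Φ ⊗ m` of `W ⊕ W`. -/
def tensorTwist (Φ : Module.End 𝕜 W) (m : Matrix (Fin 2) (Fin 2) ℤ) : Module.End 𝕜 (W × W) :=
  (Φ.prodMap Φ) * twist m

/-- The bilinear form `C ⊗ m` on `W ⊕ W`,
`(C ⊗ m)(φ, ψ) = C(φ₁, (mψ)₁) + C(φ₂, (mψ)₂)`. -/
def formTwist (C : W →ₗ[𝕜] W →ₗ[𝕜] 𝕜) (m : Matrix (Fin 2) (Fin 2) ℤ) :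
    W × W →ₗ[𝕜] W × W →ₗ[𝕜] 𝕜 :=
  (C.compl₁₂ (LinearMap.fst 𝕜 W W) (LinearMap.fst 𝕜 W W ∘ₗ twist m)) +
  (C.compl₁₂ (LinearMap.snd 𝕜 W W) (LinearMap.snd 𝕜 W W ∘ₗ twist m))

/-- Clifford multiplication on `W ⊕ W`, acting on both summands. -/
def gammaDouble (γ : T →ₗ[ℝ] Module.End 𝕜 W) : T →ₗ[ℝ] Module.End 𝕜 (W × W) where
  toFun v := (γ v).prodMap (γ v)
  map_add' v w := by ext <;> simp
  map_smul' r v := by ext <;> simp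

end Algebra

/-! ### Charge conjugations -/

section ChargeConjugation

variable {𝕜 : Type*} [RCLike 𝕜] {V : Type*} [AddCommGroup V] [Module ℝ V] {η : QuadraticForm ℝ V}
  {S₀ : Type*} [AddCommGroup S₀] [Module ℝ S₀] [Module 𝕜 S₀] [IsScalarTower ℝ 𝕜 S₀]

/-- The `γ`-matrices of a module `ρ` over the Clifford algebra of `-η`, so that
`γ(v)γ(w) + γ(w)γ(v) = -2 η(v, w)`. -/
def gammaModel (ρ : CliffordAlgebra (-η) →ₐ[ℝ] Module.End 𝕜 S₀) : V →ₗ[ℝ] Module.End 𝕜 S₀ :=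
  ρ.toLinearMap ∘ₗ CliffordAlgebra.ι (-η)

/-- A charge conjugation on a spinor module: a nondegenerate spin-invariant `𝕜`-bilinear form
such that `C` and `C(·, γ_v ·)` are symmetric or skew symmetric. -/
structure ChargeConjugation (ρ : CliffordAlgebra (-η) →ₐ[ℝ] Module.End 𝕜 S₀) where
  form : S₀ →ₗ[𝕜] S₀ →ₗ[𝕜] 𝕜
  nondegenerate : ∀ φ, (∀ ψ, form φ ψ = 0) → φ = 0
  spin_invariant : ∀ h ∈ spinGroup (-η), ∀ φ ψ, form (ρ h φ) (ρ h ψ) = form φ ψ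
  symm_zero : (∀ φ ψ, form ψ φ = form φ ψ) ∨ (∀ φ ψ, form ψ φ = -form φ ψ)
  symm_one : (∀ φ ψ v, form ψ (gammaModel ρ v φ) = form φ (gammaModel ρ v ψ)) ∨
    (∀ φ ψ v, form ψ (gammaModel ρ v φ) = -form φ (gammaModel ρ v ψ))

namespace ChargeConjugation

variable {ρ : CliffordAlgebra (-η) →ₐ[ℝ] Module.End 𝕜 S₀}

/-- The map `C_k`, with values in `k`-forms: `C_k(φ ⊗ ψ)(v₁, …, v_k) = C(φ, γ_{v₁ ⋯ v_k} ψ)`. -/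
def proj (C : ChargeConjugation ρ) (k : ℕ) (φ ψ : S₀) (v : Fin k → V) : 𝕜 :=
  C.form φ (gammaAnti (gammaModel ρ) v ψ)

open Classical in
/-- The symmetry `Δ_k` of `C_k`: `1` if `C_k` is symmetric, and `-1` otherwise. -/
def sign (C : ChargeConjugation ρ) (k : ℕ) : ℤ :=
  if ∀ φ ψ v, C.proj k ψ φ v = C.proj k φ ψ v then 1 else -1

end ChargeConjugation

end ChargeConjugation

/-! ### Pseudo-Riemannian metrics, spin structures, connections -/

section Geometry

variable {E : Type*} [NormedAddCommGroup E] [NormedSpace ℝ E]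
  {H : Type*} [TopologicalSpace H] (I : ModelWithCorners ℝ E H)
  (M : Type*) [TopologicalSpace M] [ChartedSpace H M]

/-- A smooth pseudo-Riemannian metric. -/
structure PseudoRiemannianMetric [IsManifold I ∞ M] where
  val (x : M) : TangentSpace I x →L[ℝ] TangentSpace I x →L[ℝ] ℝ
  symm (x : M) (v w : TangentSpace I x) : val x v w = val x w v
  nondegenerate (x : M) (v : TangentSpace I x) : (∀ w, val x v w = 0) → v = 0
  contMDiff : ContMDiff I (I.prod 𝓘(ℝ, E →L[ℝ] E →L[ℝ] ℝ)) ∞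
    (fun x => TotalSpace.mk' (E →L[ℝ] E →L[ℝ] ℝ)
      (E := fun x : M => TangentSpace I x →L[ℝ] TangentSpace I x →L[ℝ] ℝ) x (val x))

variable {I M}

namespace PseudoRiemannianMetric

variable [IsManifold I ∞ M]

/-- The metric at a point, as an algebraic bilinear form. -/
def bilin (g : PseudoRiemannianMetric I M) (x : M) : LinearMap.BilinForm ℝ (TangentSpace I x) :=
  LinearMap.mk₂ ℝ (fun v w => g.val x v w) (by simp) (by simp) (by simp) (by simp)

theorem bilin_nondegenerate (g : PseudoRiemannianMetric I M) (x : M) :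
    (g.bilin x).Nondegenerate :=
  ⟨fun v hv => g.nondegenerate x v hv,
    fun v hv => g.nondegenerate x v fun w => by rw [g.symm]; exact hv w⟩

end PseudoRiemannianMetric

/-- Differentiability at `x` of a section of a vector bundle with model fibre `F`. -/
abbrev SectionDiffAt (I : ModelWithCorners ℝ E H) (F : Type*) [NormedAddCommGroup F]
    [NormedSpace ℝ F] {W : M → Type*} [TopologicalSpace (TotalSpace F W)]
    [∀ x, TopologicalSpace (W x)] [FiberBundle F W] (σ : Π x, W x) (x : M) : Prop :=
  MDifferentiableAt I (I.prod 𝓘(ℝ, F)) (fun y => TotalSpace.mk' F y (σ y)) x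

/-- `nabla` is the Levi-Civita connection of `g`: it is torsion free and metric. -/
def IsLeviCivita [FiniteDimensional ℝ E] [IsManifold I ∞ M] (g : PseudoRiemannianMetric I M)
    (nabla : CovariantDerivative I E (TangentSpace I : M → Type _)) : Prop :=
  nabla.torsion = 0 ∧
  ∀ (x : M) (X Y : Π x : M, TangentSpace I x) (Z : TangentSpace I x),
    SectionDiffAt I E X x → SectionDiffAt I E Y x →
    mvfderiv I (fun y => g.val y (X y) (Y y)) x Z =
      g.val x (nabla X x Z) (Y x) + g.val x (X x) (nabla Y x Z)

section SpinStructure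

variable {𝕜 : Type*} [RCLike 𝕜] {V : Type*} [AddCommGroup V] [Module ℝ V] {η : QuadraticForm ℝ V}
  {S₀ : Type*} [AddCommGroup S₀] [Module ℝ S₀] [Module 𝕜 S₀] [IsScalarTower ℝ 𝕜 S₀]
  {F : Type*} [NormedAddCommGroup F] [NormedSpace ℝ F]

/-- A spin structure on `(M, g)`, together with an identification of the vector bundle `S` with
the spinor bundle associated to it and to the Clifford module `ρ` on `S₀`; the metric has the type
of the model quadratic space `(V, η)`. It is given by local spin frames, one around each point `p`.
A spin frame on an open set consists of a smooth orthonormal frame of `TM`, written as isometries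
`vecFrame p x : V ≃ T_x M`, and of a smooth frame `spinFrame p x : S₀ ≃ S_x` of `S`. Two spin
frames differ by elements `h` of the spin group, where `h` acts on `V` through the covering
`v ↦ h v h⁻¹` of the orthogonal group (`star h = h⁻¹`) and on `S₀` through `ρ`.
(The values of the frames outside their domain are irrelevant.) -/
structure SpinStructure [IsManifold I ∞ M] (g : PseudoRiemannianMetric I M)
    (ρ : CliffordAlgebra (-η) →ₐ[ℝ] Module.End 𝕜 S₀) (F : Type*) [NormedAddCommGroup F]
    [NormedSpace ℝ F] (S : M → Type*) [TopologicalSpace (TotalSpace F S)]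
    [∀ x, AddCommGroup (S x)] [∀ x, Module ℝ (S x)] [∀ x, Module 𝕜 (S x)]
    [∀ x, TopologicalSpace (S x)] [FiberBundle F S] [VectorBundle ℝ F S] where
  domain : M → Set M
  isOpen_domain (p : M) : IsOpen (domain p)
  mem_domain (p : M) : p ∈ domain p
  vecFrame (p x : M) : V ≃ₗ[ℝ] TangentSpace I x
  spinFrame (p x : M) : S₀ ≃ₗ[𝕜] S x
  vecFrame_isometry (p : M) : ∀ x ∈ domain p, ∀ v,
    g.val x (vecFrame p x v) (vecFrame p x v) = η v
  vecFrame_smooth (p : M) (v : V) : ContMDiffOn I (I.prod 𝓘(ℝ, E)) ∞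
    (fun x => TotalSpace.mk' E (E := (TangentSpace I : M → Type _)) x (vecFrame p x v)) (domain p)
  spinFrame_smooth (p : M) (φ : S₀) : ContMDiffOn I (I.prod 𝓘(ℝ, F)) ∞
    (fun x => TotalSpace.mk' F x (spinFrame p x φ)) (domain p)
  transition (p q : M) : ∀ x ∈ domain p ∩ domain q, ∃ h ∈ spinGroup (-η),
    (∀ v, CliffordAlgebra.ι (-η) ((vecFrame p x).symm (vecFrame q x v)) =
      h * CliffordAlgebra.ι (-η) v * star h) ∧
    (∀ φ, spinFrame q x φ = spinFrame p x (ρ h φ))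

/-- The Lie algebra `spin(V)` inside the Clifford algebra, spanned by the commutators of
vectors. -/
def spinLieAlgebra (Q : QuadraticForm ℝ V) : Submodule ℝ (CliffordAlgebra Q) :=
  Submodule.span ℝ {a | ∃ v w, a = CliffordAlgebra.ι Q v * CliffordAlgebra.ι Q w -
    CliffordAlgebra.ι Q w * CliffordAlgebra.ι Q v}

namespace SpinStructure

variable [IsManifold I ∞ M] {g : PseudoRiemannianMetric I M}
  {ρ : CliffordAlgebra (-η) →ₐ[ℝ] Module.End 𝕜 S₀}
  {S : M → Type*} [TopologicalSpace (TotalSpace F S)]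
  [∀ x, AddCommGroup (S x)] [∀ x, Module ℝ (S x)] [∀ x, Module 𝕜 (S x)]
  [∀ x, IsScalarTower ℝ 𝕜 (S x)]
  [∀ x, TopologicalSpace (S x)] [FiberBundle F S] [VectorBundle ℝ F S]

/-- Clifford multiplication `T_x M → End(S_x)`, computed in the spin frame around `x` (it does
not depend on the spin frame). -/
def gamma (P : SpinStructure g ρ F S) (x : M) :
    TangentSpace I x →ₗ[ℝ] Module.End 𝕜 (S x) where
  toFun v := (P.spinFrame x x).toLinearMap ∘ₗ
    gammaModel ρ ((P.vecFrame x x).symm v) ∘ₗ (P.spinFrame x x).symm.toLinearMap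
  map_add' v w := by ext φ; simp
  map_smul' r v := by
    ext φ
    have h (a : S₀) : P.spinFrame x x (r • a) = r • P.spinFrame x x a := by
      rw [← algebraMap_smul 𝕜 r a, map_smul, algebraMap_smul]
    simp [h]

/-- The charge conjugation on `S_x`, computed in the spin frame around `x` (it does not depend on
the spin frame). -/
def form (P : SpinStructure g ρ F S) (C : ChargeConjugation ρ) (x : M) :
    S x →ₗ[𝕜] S x →ₗ[𝕜] 𝕜 :=
  C.form.compl₁₂ (P.spinFrame x x).symm.toLinearMap (P.spinFrame x x).symm.toLinearMap

/-- `nablaS` is the connection on `S` induced by the connection `nabla` on `TM`: in each spin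
frame, the connection form of `nablaS` is `ρ(a)`, where `a` is the connection form of `nabla`
lifted to `spin(V)` along the differential `a ↦ [a, ·]` of the covering of the orthogonal group. -/
def IsInducedConnection [∀ x, IsTopologicalAddGroup (S x)] [∀ x, ContinuousSMul ℝ (S x)]
    (P : SpinStructure g ρ F S)
    (nabla : CovariantDerivative I E (TangentSpace I : M → Type _))
    (nablaS : CovariantDerivative I F S) : Prop :=
  ∀ (p : M), ∀ x ∈ P.domain p, ∀ X : TangentSpace I x, ∃ a ∈ spinLieAlgebra (-η),
    (∀ v, a * CliffordAlgebra.ι (-η) v - CliffordAlgebra.ι (-η) v * a =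
      CliffordAlgebra.ι (-η)
        ((P.vecFrame p x).symm (nabla (fun y => P.vecFrame p y v) x X))) ∧
    (∀ φ, nablaS (fun y => P.spinFrame p y φ) x X = P.spinFrame p x (ρ a φ))

end SpinStructure

end SpinStructure

section Connections

variable {F : Type*} [NormedAddCommGroup F] [NormedSpace ℝ F]
  {W : M → Type*} [TopologicalSpace (TotalSpace F W)]
  [∀ x, AddCommGroup (W x)] [∀ x, Module ℝ (W x)]
  [∀ x, TopologicalSpace (W x)] [∀ x, IsTopologicalAddGroup (W x)] [∀ x, ContinuousSMul ℝ (W x)]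
  [FiberBundle F W]

/-- The connection `D + A` for an `End(W)`-valued one-form `A`. -/
def addOneForm [FiniteDimensional ℝ E] (D : CovariantDerivative I F W)
    (A : Π x : M, TangentSpace I x →ₗ[ℝ] W x →ₗ[ℝ] W x) : CovariantDerivative I F W where
  toFun σ x :=
    haveI : T2Space (TangentSpace I x) := inferInstanceAs (T2Space E)
    haveI : FiniteDimensional ℝ (TangentSpace I x) := inferInstanceAs (FiniteDimensional ℝ E)
    D σ x + LinearMap.toContinuousLinearMap ((A x).flip (σ x))
  isCovariantDerivativeOnUniv :=
    { add := fun hσ hσ' _ => by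
        rw [D.isCovariantDerivativeOnUniv.add hσ hσ']
        simp
        abel
      leibniz := fun hσ hg _ => by
        rw [D.isCovariantDerivativeOnUniv.leibniz hσ hg]
        simp
        abel }

theorem addOneForm_apply [FiniteDimensional ℝ E] (D : CovariantDerivative I F W)
    (A : Π x : M, TangentSpace I x →ₗ[ℝ] W x →ₗ[ℝ] W x) (σ : Π x, W x) (x : M)
    (X : TangentSpace I x) : addOneForm D A σ x X = D σ x X + A x X (σ x) := rfl

/-- The direct sum of two connections. -/
def directSum {F' : Type*} [NormedAddCommGroup F'] [NormedSpace ℝ F']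
    {W' : M → Type*} [TopologicalSpace (TotalSpace F' W')]
    [∀ x, AddCommGroup (W' x)] [∀ x, Module ℝ (W' x)]
    [∀ x, TopologicalSpace (W' x)] [∀ x, IsTopologicalAddGroup (W' x)]
    [∀ x, ContinuousSMul ℝ (W' x)] [FiberBundle F' W']
    (D : CovariantDerivative I F W) (D' : CovariantDerivative I F' W') :
    CovariantDerivative I (F × F') (W ×ᵇ W') where
  toFun σ x := (D (fun y => (σ y).1) x).prod (D' (fun y => (σ y).2) x)
  isCovariantDerivativeOnUniv := by
    have h1 {σ : Π x, (W ×ᵇ W') x} {x : M} (h : SectionDiffAt I (F × F') σ x) :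
        SectionDiffAt I F (fun y => (σ y).1) x := by
      rw [SectionDiffAt, mdifferentiableAt_section] at h ⊢
      exact (ContinuousLinearMap.fst ℝ F F').mdifferentiableAt.comp x h
    have h2 {σ : Π x, (W ×ᵇ W') x} {x : M} (h : SectionDiffAt I (F × F') σ x) :
        SectionDiffAt I F' (fun y => (σ y).2) x := by
      rw [SectionDiffAt, mdifferentiableAt_section] at h ⊢
      exact (ContinuousLinearMap.snd ℝ F F').mdifferentiableAt.comp x h
    refine ⟨fun {σ σ' x} hσ hσ' _ => ?_, fun {σ g x} hσ hg _ => ?_⟩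
    · have e1 := D.isCovariantDerivativeOnUniv.add (h1 hσ) (h1 hσ')
      have e2 := D'.isCovariantDerivativeOnUniv.add (h2 hσ) (h2 hσ')
      ext X
      · exact congrArg (fun L => L X) e1
      · exact congrArg (fun L => L X) e2
    · have e1 := D.isCovariantDerivativeOnUniv.leibniz (h1 hσ) hg
      have e2 := D'.isCovariantDerivativeOnUniv.leibniz (h2 hσ) hg
      ext X
      · exact congrArg (fun L => L X) e1
      · exact congrArg (fun L => L X) e2

variable [IsManifold I ∞ M] {𝕜 : Type*} [RCLike 𝕜] [∀ x, Module 𝕜 (W x)]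
  [∀ x, IsScalarTower ℝ 𝕜 (W x)]

/-- `DC` is the connection `D^C` associated to `D` and the bilinear form `B`: the connection
`D ⊗ 1 + 1 ⊗ D^C` makes `B` parallel. -/
def IsChargeDual (B : Π x : M, W x →ₗ[𝕜] W x →ₗ[𝕜] 𝕜) (D DC : CovariantDerivative I F W) : Prop :=
  ∀ (x : M) (σ τ : Π x, W x) (X : TangentSpace I x),
    SectionDiffAt I F σ x → SectionDiffAt I F τ x →
    mvfderiv I (fun y => B y (σ y) (τ y)) x X = B x (D σ x X) (τ x) + B x (σ x) (DC τ x X)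

/-- `((D̂_X γ)(Y)) ξ = D_X (γ(Y) ξ) - γ(∇_X Y) ξ - γ(Y) D^C_X ξ`. -/
def hatD (nabla : CovariantDerivative I E (TangentSpace I : M → Type _))
    (γ : Π x : M, TangentSpace I x →ₗ[ℝ] Module.End 𝕜 (W x)) (D DC : CovariantDerivative I F W)
    (X Y : Π x : M, TangentSpace I x) (ξ : Π x, W x) (x : M) : W x :=
  D (fun y => γ y (Y y) (ξ y)) x (X x) - γ x (nabla Y x (X x)) (ξ x) - γ x (Y x) (DC ξ x (X x))

/-- The connection `D` on `W` is admissible: `D̂γ` is skew symmetric. (For a nondegenerate form `B`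
the connection `D^C` exists and is unique.) -/
def Admissible (nabla : CovariantDerivative I E (TangentSpace I : M → Type _))
    (γ : Π x : M, TangentSpace I x →ₗ[ℝ] Module.End 𝕜 (W x))
    (B : Π x : M, W x →ₗ[𝕜] W x →ₗ[𝕜] 𝕜) (D : CovariantDerivative I F W) : Prop :=
  ∃ DC : CovariantDerivative I F W, IsChargeDual B D DC ∧
    ∀ (x : M) (X Y : Π x : M, TangentSpace I x) (ξ : Π x, W x),
      SectionDiffAt I E X x → SectionDiffAt I E Y x → SectionDiffAt I F ξ x →
      hatD nabla γ D DC X Y ξ x = - hatD nabla γ D DC Y X ξ x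

end Connections

section Twisted

variable {𝕜 : Type*} [RCLike 𝕜] {V : Type*} [AddCommGroup V] [Module ℝ V] {η : QuadraticForm ℝ V}
  {S₀ : Type*} [AddCommGroup S₀] [Module ℝ S₀] [Module 𝕜 S₀] [IsScalarTower ℝ 𝕜 S₀]
  {F : Type*} [NormedAddCommGroup F] [NormedSpace ℝ F]
  [IsManifold I ∞ M] {g : PseudoRiemannianMetric I M}
  {ρ : CliffordAlgebra (-η) →ₐ[ℝ] Module.End 𝕜 S₀}
  {S : M → Type*} [TopologicalSpace (TotalSpace F S)]
  [∀ x, AddCommGroup (S x)] [∀ x, Module ℝ (S x)] [∀ x, Module 𝕜 (S x)]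
  [∀ x, IsScalarTower ℝ 𝕜 (S x)]
  [∀ x, TopologicalSpace (S x)] [FiberBundle F S] [VectorBundle ℝ F S]

/-- The `End(S ⊕ S)`-valued one-form `X ↦ (1/ℓ!) F_{i₁ ⋯ i_ℓ} γ^{i₁ ⋯ i_ℓ} γ(X) ⊗ τ_j`. -/
def contribution [FiniteDimensional ℝ E] (P : SpinStructure g ρ F S) {ℓ : ℕ}
    (α : Π x : M, TangentSpace I x [⋀^Fin ℓ]→ₗ[ℝ] 𝕜) (j : Fin 4) (x : M) :
    TangentSpace I x →ₗ[ℝ] (S ×ᵇ S) x →ₗ[ℝ] (S ×ᵇ S) x :=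
  haveI : FiniteDimensional ℝ (TangentSpace I x) := inferInstanceAs (FiniteDimensional ℝ E)
  LinearMap.mk₂ ℝ
    (fun X ξ => tensorTwist
      (formEnd (P.gamma x) (g.bilin x) (g.bilin_nondegenerate x) (α x) * P.gamma x X) (tau j) ξ)
    (by intro X Y ξ; ext <;> simp [tensorTwist])
    (by intro r X ξ; ext <;> simp [tensorTwist])
    (by intro X ξ ζ; simp)
    (by
      intro r X ξ
      rw [← algebraMap_smul 𝕜 r ξ, map_smul, algebraMap_smul])

/-- Admissibility of a connection on the twisted spinor bundle `S ⊕ S` with charge conjugation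
`C ⊗ τ_i`. -/
def TwistedAdmissible (P : SpinStructure g ρ F S) (C : ChargeConjugation ρ)
    [∀ x, IsTopologicalAddGroup (S x)] [∀ x, ContinuousSMul ℝ (S x)]
    (nabla : CovariantDerivative I E (TangentSpace I : M → Type _)) (i : Fin 4)
    (D : CovariantDerivative I (F × F) (S ×ᵇ S)) : Prop :=
  Admissible (𝕜 := 𝕜) nabla (fun x => gammaDouble (P.gamma x))
    (fun x => formTwist (P.form C x) (tau i)) D

end Twisted

end Geometry

end SpinorConnection

end

noncomputable section

set_option linter.unusedSectionVars false

namespace SpinorConnection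

section Algebra

variable {𝕜 : Type*} [RCLike 𝕜] {T : Type*} [AddCommGroup T] [Module ℝ T]
  {W : Type*} [AddCommGroup W] [Module ℝ W] [Module 𝕜 W] [IsScalarTower ℝ 𝕜 W]

/-- The complete contraction of the components of an alternating form with a product of
endomorphisms. -/
def contraction {ι : Type*} [Fintype ι] (Γ : ι → Module.End 𝕜 W) (b : ι → T) {ℓ : ℕ}
    (F : T [⋀^Fin ℓ]→ₗ[ℝ] 𝕜) : Module.End 𝕜 W :=
  ∑ f : Fin ℓ → ι, F (fun a => b (f a)) • (List.ofFn fun a => Γ (f a)).prod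

section Contraction

variable {ι : Type*} [Fintype ι] (Γ : ι → Module.End 𝕜 W) (b : ι → T)

theorem contraction_zero (F : T [⋀^Fin 0]→ₗ[ℝ] 𝕜) :
    contraction Γ b F = F ![] • (1 : Module.End 𝕜 W) := by
  simp [contraction, Matrix.empty_eq]

theorem contraction_succ {ℓ : ℕ} (F : T [⋀^Fin (ℓ + 1)]→ₗ[ℝ] 𝕜) :
    contraction Γ b F = ∑ i, Γ i * contraction Γ b (F.curryLeft (b i)) := by
  rw [contraction, ← (Fin.consEquiv fun _ : Fin (ℓ + 1) => ι).sum_comp, Fintype.sum_prod_type]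
  refine Finset.sum_congr rfl fun i _ => ?_
  rw [contraction, Finset.mul_sum]
  refine Finset.sum_congr rfl fun f _ => ?_
  have h : (fun a => b ((Fin.consEquiv fun _ : Fin (ℓ + 1) => ι) (i, f) a)) =
      Matrix.vecCons (b i) (fun a => b (f a)) := by
    funext a
    refine Fin.cases ?_ (fun a => ?_) a <;> simp [Fin.consEquiv]
  rw [h, AlternatingMap.curryLeft_apply_apply, List.ofFn_succ, List.prod_cons]
  simp [Fin.consEquiv]

theorem contraction_add {ℓ : ℕ} (F G : T [⋀^Fin ℓ]→ₗ[ℝ] 𝕜) :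
    contraction Γ b (F + G) = contraction Γ b F + contraction Γ b G := by
  simp [contraction, add_smul, Finset.sum_add_distrib]

theorem contraction_smul {ℓ : ℕ} (r : ℝ) (F : T [⋀^Fin ℓ]→ₗ[ℝ] 𝕜) :
    contraction Γ b (r • F) = r • contraction Γ b F := by
  simp [contraction, Finset.smul_sum, smul_assoc]

/-- Contraction as a linear map on forms. -/
def contractionHom (ℓ : ℕ) : T [⋀^Fin ℓ]→ₗ[ℝ] 𝕜 →ₗ[ℝ] Module.End 𝕜 W where
  toFun F := contraction Γ b F
  map_add' := contraction_add Γ b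
  map_smul' := contraction_smul Γ b

variable {Γ b}

/-- The graded commutator of a vector with a form is the interior product. -/
theorem mul_contraction (γ : T →ₗ[ℝ] Module.End 𝕜 W) (c : T → ι → ℝ)
    (hb : ∀ v, ∑ i, c v i • b i = v)
    (hγ : ∀ v i, γ v * Γ i + Γ i * γ v = (-2 * c v i) • (1 : Module.End 𝕜 W)) (v : T) :
    ∀ {ℓ : ℕ} (F : T [⋀^Fin (ℓ + 1)]→ₗ[ℝ] 𝕜),
      γ v * contraction Γ b F = (-1 : ℝ) ^ (ℓ + 1) • (contraction Γ b F * γ v) -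
        (2 * (ℓ + 1) : ℝ) • contraction Γ b (F.curryLeft v) := by
  have key {ℓ : ℕ} (F : T [⋀^Fin (ℓ + 1)]→ₗ[ℝ] 𝕜) :
      ∑ i, c v i • contraction Γ b (F.curryLeft (b i)) = contraction Γ b (F.curryLeft v) := by
    have h := congrArg (fun u => contractionHom Γ b ℓ (F.curryLeft u)) (hb v)
    simpa [contractionHom, contraction_smul, -AlternatingMap.curryLeft_apply_apply] using h
  have step {ℓ : ℕ} (F : T [⋀^Fin (ℓ + 1)]→ₗ[ℝ] 𝕜) :
      γ v * contraction Γ b F = (-2 : ℝ) • contraction Γ b (F.curryLeft v) -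
        ∑ i, Γ i * (γ v * contraction Γ b (F.curryLeft (b i))) := by
    rw [← key, contraction_succ, Finset.mul_sum, Finset.smul_sum, ← Finset.sum_sub_distrib]
    refine Finset.sum_congr rfl fun i _ => ?_
    rw [← mul_assoc, ← mul_assoc, eq_sub_of_add_eq (hγ v i), sub_mul, smul_mul_assoc, one_mul,
      smul_smul]
  intro ℓ
  induction ℓ with
  | zero =>
    intro F
    rw [step, contraction_succ, Finset.sum_mul]
    simp only [contraction_zero]
    simp
    abel
  | succ ℓ ih =>
    intro F
    rw [step]
    have h (i) : Γ i * (γ v * contraction Γ b (F.curryLeft (b i))) =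
        (-1 : ℝ) ^ (ℓ + 1) • (Γ i * contraction Γ b (F.curryLeft (b i)) * γ v) +
        (2 * (ℓ + 1) : ℝ) • (Γ i * contraction Γ b ((F.curryLeft v).curryLeft (b i))) := by
      have e : (F.curryLeft (b i)).curryLeft v = -(F.curryLeft v).curryLeft (b i) := by
        ext w
        have h := F.map_swap (Matrix.vecCons v (Matrix.vecCons (b i) w)) (i := 0) (j := 1) (by simp)
        simp only [AlternatingMap.curryLeft_apply_apply, AlternatingMap.neg_apply]
        rw [← h]
        congr 1
        funext a
        refine Fin.cases ?_ (fun a => Fin.cases ?_ (fun a => ?_) a) a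
        · simp
        · simp
        · simp [Equiv.swap_apply_of_ne_of_ne, Fin.ext_iff]
      rw [ih, e, ← neg_one_smul ℝ ((F.curryLeft v).curryLeft (b i)), contraction_smul]
      simp [mul_add, mul_assoc]
    simp only [h, Finset.sum_add_distrib, ← Finset.smul_sum, ← contraction_succ, ← Finset.sum_mul]
    push_cast
    module

theorem eq_zero_of_contraction_eq_zero [Nontrivial W] (γ : T →ₗ[ℝ] Module.End 𝕜 W)
    (c : T → ι → ℝ) (hb : ∀ v, ∑ i, c v i • b i = v)
    (hγ : ∀ v i, γ v * Γ i + Γ i * γ v = (-2 * c v i) • (1 : Module.End 𝕜 W)) :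
    ∀ {ℓ : ℕ} (F : T [⋀^Fin ℓ]→ₗ[ℝ] 𝕜), contraction Γ b F = 0 → F = 0 := by
  intro ℓ
  induction ℓ with
  | zero =>
    intro F hF
    rw [contraction_zero] at hF
    have : F ![] = 0 := by simpa using hF
    ext v
    simpa [Matrix.empty_eq] using this
  | succ ℓ ih =>
    intro F hF
    have h (v : T) : F.curryLeft v = 0 := by
      apply ih
      have h := mul_contraction γ c hb hγ v F
      rw [hF, mul_zero, zero_mul, smul_zero, zero_sub, eq_comm, neg_eq_zero] at h
      exact (smul_eq_zero.1 h).resolve_left (by positivity)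
    ext v
    have := congrArg (fun G => G (Matrix.vecTail v)) (h (v 0))
    rw [AlternatingMap.curryLeft_apply_apply] at this
    simpa [show Matrix.vecCons (v 0) (Matrix.vecTail v) = v from Matrix.cons_head_tail v] using this

end Contraction

theorem formEnd_eq_contraction [FiniteDimensional ℝ T] (γ : T →ₗ[ℝ] Module.End 𝕜 W)
    (B : LinearMap.BilinForm ℝ T) (hB : B.Nondegenerate) {ℓ : ℕ} (F : T [⋀^Fin ℓ]→ₗ[ℝ] 𝕜) :
    formEnd γ B hB F = ((Nat.factorial ℓ : 𝕜)⁻¹) •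
      contraction (fun i => γ (B.dualBasis hB (Module.finBasis ℝ T) i)) (Module.finBasis ℝ T) F := by
  classical
  have hℓ : (Nat.factorial ℓ : 𝕜) ≠ 0 := by exact_mod_cast Nat.factorial_ne_zero ℓ
  rw [formEnd, contraction]
  congr 1
  simp only [gammaAnti, smul_comm (F _) ((Nat.factorial ℓ : 𝕜)⁻¹)]
  rw [← Finset.smul_sum, inv_smul_eq_iff₀ hℓ]
  simp only [Finset.smul_sum]
  rw [Finset.sum_comm]
  trans ∑ _s : Equiv.Perm (Fin ℓ), ∑ f : Fin ℓ → Fin (finrank ℝ T),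
      F (fun a => Module.finBasis ℝ T (f a)) •
        (List.ofFn fun a => γ (B.dualBasis hB (Module.finBasis ℝ T) (f a))).prod
  · refine Finset.sum_congr rfl fun s _ => ?_
    rw [← (Equiv.arrowCongr s (Equiv.refl (Fin (finrank ℝ T)))).sum_comp]
    refine Finset.sum_congr rfl fun f _ => ?_
    have e := F.map_perm (fun a => Module.finBasis ℝ T (f (s.symm a))) s
    simp only [Equiv.arrowCongr_apply, Function.comp_def, Equiv.refl_apply, Equiv.symm_apply_apply]
      at e ⊢
    rw [e]
    rcases Int.units_eq_one_or (Equiv.Perm.sign s) with h | h <;> simp [h]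
  · simp [Fintype.card_perm, ← Nat.cast_smul_eq_nsmul 𝕜, Finset.smul_sum]

theorem eq_zero_of_formEnd_eq_zero [FiniteDimensional ℝ T] [Nontrivial W]
    (γ : T →ₗ[ℝ] Module.End 𝕜 W) (B : LinearMap.BilinForm ℝ T) (hB : B.Nondegenerate)
    (hγ : ∀ v w, γ v * γ w + γ w * γ v = (-2 * B v w) • (1 : Module.End 𝕜 W))
    {ℓ : ℕ} (F : T [⋀^Fin ℓ]→ₗ[ℝ] 𝕜) (hF : formEnd γ B hB F = 0) : F = 0 := by
  classical
  have hℓ : (Nat.factorial ℓ : 𝕜) ≠ 0 := by exact_mod_cast Nat.factorial_ne_zero ℓ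
  rw [formEnd_eq_contraction] at hF
  refine eq_zero_of_contraction_eq_zero γ
    (fun v i => B (B.dualBasis hB (Module.finBasis ℝ T) i) v) (fun v => ?_) (fun v i => ?_) F
    ((smul_eq_zero.1 hF).resolve_left (inv_ne_zero hℓ))
  · conv_rhs => rw [← (Module.finBasis ℝ T).sum_repr v]
    refine Finset.sum_congr rfl fun i _ => ?_
    congr 1
    conv_lhs => rw [← (Module.finBasis ℝ T).sum_repr v]
    rw [map_sum]
    simp [LinearMap.BilinForm.apply_dualBasis_left, -Basis.sum_repr]
  · rw [add_comm, hγ]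

/-! ### Adjoints -/

theorem adjoint_list_prod (C : W →ₗ[𝕜] W →ₗ[𝕜] 𝕜) (t : 𝕜) (L : List (Module.End 𝕜 W))
    (hL : ∀ A ∈ L, ∀ φ ψ, C (A φ) ψ = t * C φ (A ψ)) (φ ψ : W) :
    C (L.prod φ) ψ = t ^ L.length * C φ (L.reverse.prod ψ) := by
  induction L generalizing φ ψ with
  | nil => simp
  | cons A L ih =>
    simp only [List.prod_cons, Module.End.mul_apply, List.length_cons, List.reverse_cons,
      List.prod_append, List.prod_nil, mul_one]
    rw [hL A (by simp), ih (fun B hB => hL B (by simp [hB]))]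
    ring

/-- The sign `(-1)^(k(k-1)/2)` of the reversal of `k` letters. -/
theorem sign_revPerm (k : ℕ) :
    Equiv.Perm.sign (Fin.revPerm : Equiv.Perm (Fin k)) = (-1) ^ (k * (k - 1) / 2) := by
  rw [Equiv.Perm.sign_eq_prod_prod_Iio]
  have h (j : Fin k) : (∏ i ∈ Finset.Iio j,
      if (Fin.revPerm : Equiv.Perm (Fin k)) i < (Fin.revPerm : Equiv.Perm (Fin k)) j
        then (1 : ℤˣ) else -1) = (-1) ^ (j : ℕ) := by
    rw [Finset.prod_congr rfl (g := fun _ => (-1 : ℤˣ))]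
    · simp
    · intro i hi
      simp only [Finset.mem_Iio] at hi
      simp [hi.le]
  simp only [h]
  rw [Finset.prod_pow_eq_pow_sum, Fin.sum_univ_eq_sum_range (fun i => i), Finset.sum_range_id]

theorem gammaAnti_rev (γ : T →ₗ[ℝ] Module.End 𝕜 W) {k : ℕ} (v : Fin k → T) :
    gammaAnti γ v = ((Nat.factorial k : 𝕜)⁻¹) • ∑ s : Equiv.Perm (Fin k),
      ((Equiv.Perm.sign (Fin.revPerm : Equiv.Perm (Fin k)) : ℤ) * (Equiv.Perm.sign s : ℤ)) •
        (List.ofFn fun a => γ (v (s a))).reverse.prod := by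
  rw [gammaAnti]
  congr 1
  rw [← Equiv.sum_comp (Equiv.mulRight (Fin.revPerm : Equiv.Perm (Fin k)))]
  refine Finset.sum_congr rfl fun s _ => ?_
  congr 1
  · simp [mul_comm]
  · congr 1
    refine List.ext_getElem (by simp) fun i h1 h2 => ?_
    simp only [List.getElem_ofFn, List.getElem_reverse, List.length_ofFn, Equiv.coe_mulRight,
      Equiv.Perm.mul_apply, Fin.revPerm_apply]
    congr 3
    simp [Fin.ext_iff]
    omega

theorem adjoint_gammaAnti (γ : T →ₗ[ℝ] Module.End 𝕜 W) (C : W →ₗ[𝕜] W →ₗ[𝕜] 𝕜) (t : 𝕜)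
    (hC : ∀ v φ ψ, C (γ v φ) ψ = t * C φ (γ v ψ)) {k : ℕ} (v : Fin k → T) (φ ψ : W) :
    C (gammaAnti γ v φ) ψ = t ^ k * (-1) ^ (k * (k - 1) / 2) * C φ (gammaAnti γ v ψ) := by
  conv_rhs => rw [gammaAnti_rev γ v, sign_revPerm]
  rw [gammaAnti]
  simp only [LinearMap.smul_apply, LinearMap.sum_apply, map_smul, map_sum, smul_eq_mul,
    Finset.mul_sum]
  refine Finset.sum_congr rfl fun s _ => ?_
  rw [map_zsmul, map_zsmul, LinearMap.smul_apply, adjoint_list_prod C t]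
  · have h : ((-1 : 𝕜) ^ (k * (k - 1) / 2)) * (-1) ^ (k * (k - 1) / 2) = 1 := by
      rw [← mul_pow]; simp
    simp only [List.length_ofFn, zsmul_eq_mul]
    push_cast
    linear_combination (-((Nat.factorial k : 𝕜)⁻¹) * t ^ k * ((Equiv.Perm.sign s : ℤ) : 𝕜) *
      C φ ((List.ofFn fun a => γ (v (s a))).reverse.prod ψ)) * h
  · intro A hA
    obtain ⟨a, rfl⟩ := by simpa [List.mem_ofFn] using hA
    exact hC _

end Algebra

/-! ### The table -/

theorem neg_one_pow_half_mod_four (ℓ : ℕ) :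
    (-1 : ℤ) ^ (ℓ * (ℓ - 1) / 2) = (-1) ^ ((ℓ % 4) * (ℓ % 4 - 1) / 2) := by
  have hp (n : ℕ) : (n + 4) * (n + 4 - 1) / 2 = n * (n - 1) / 2 + 2 * (2 * n + 3) := by
    rcases n with _ | n
    · rfl
    · have : (n + 1 + 4) * (n + 1 + 4 - 1) = (n + 1) * (n + 1 - 1) + (2 * (2 * (n + 1) + 3)) * 2 := by
        simp only [Nat.add_sub_cancel, show n + 1 + 4 - 1 = n + 4 by omega]
        ring
      rw [this, Nat.add_mul_div_right _ _ (by norm_num)]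
  induction ℓ using Nat.strong_induction_on with
  | _ ℓ ih =>
    by_cases h : ℓ < 4
    · rw [Nat.mod_eq_of_lt h]
    · obtain ⟨m, rfl⟩ : ∃ m, ℓ = m + 4 := ⟨ℓ - 4, by omega⟩
      rw [hp, pow_add, pow_mul, ih m (by omega), Nat.add_mod_right]
      simp

theorem inTable_mod_four (δ : ℤ) (ℓ : ℕ) (i j : Fin 4) :
    InTable δ (ℓ % 4) i j ↔ InTable δ ℓ i j := by
  simp [InTable, Int.ModEq]

theorem sign_eq_neg_one_iff_inTable {δ : ℤ} (hδ : δ = 1 ∨ δ = -1) (ℓ : ℕ) (i j : Fin 4) :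
    δ ^ (ℓ + 1) * (-1) ^ (ℓ * (ℓ - 1) / 2) * eps j * epsComm i j = -1 ↔ InTable δ ℓ i j := by
  have hp : δ ^ (ℓ + 1) = δ ^ (ℓ % 4 + 1) := by
    have h4 : δ ^ 4 = 1 := by rcases hδ with rfl | rfl <;> norm_num
    conv_lhs => rw [← Nat.div_add_mod ℓ 4]
    rw [add_assoc, pow_add, pow_mul, h4, one_pow, one_mul]
  rw [hp, neg_one_pow_half_mod_four, ← inTable_mod_four]
  have hlt : ℓ % 4 < 4 := Nat.mod_lt _ (by norm_num)
  generalize ℓ % 4 = r at hlt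
  unfold InTable Int.ModEq
  revert i j
  rcases hδ with rfl | rfl <;> interval_cases r <;> decide

section ChargeConjugation

variable {𝕜 : Type*} [RCLike 𝕜] {V : Type*} [AddCommGroup V] [Module ℝ V] {η : QuadraticForm ℝ V}
  {S₀ : Type*} [AddCommGroup S₀] [Module ℝ S₀] [Module 𝕜 S₀] [IsScalarTower ℝ 𝕜 S₀]
  {ρ : CliffordAlgebra (-η) →ₐ[ℝ] Module.End 𝕜 S₀}

namespace ChargeConjugation

variable (C : ChargeConjugation ρ)

theorem sign_eq_one_or (k : ℕ) : C.sign k = 1 ∨ C.sign k = -1 := by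
  unfold sign; split_ifs <;> simp

theorem proj_swap_of_exists {k : ℕ} {r : ℤ} (hr : r = 1 ∨ r = -1)
    (h : ∀ φ ψ v, C.proj k ψ φ v = (r : 𝕜) * C.proj k φ ψ v) (φ ψ : S₀) (v : Fin k → V) :
    C.proj k ψ φ v = (C.sign k : 𝕜) * C.proj k φ ψ v := by
  unfold sign
  split_ifs with hs
  · simpa using hs φ ψ v
  · rcases hr with rfl | rfl
    · exact absurd (fun φ ψ v => by simpa using h φ ψ v) hs
    · exact h φ ψ v

theorem proj_zero (φ ψ : S₀) (v : Fin 0 → V) : C.proj 0 φ ψ v = C.form φ ψ := by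
  simp [proj, gammaAnti]

theorem proj_one (φ ψ : S₀) (v : Fin 1 → V) :
    C.proj 1 φ ψ v = C.form φ (gammaModel ρ (v 0) ψ) := by
  simp [proj, gammaAnti]

theorem form_swap (φ ψ : S₀) : C.form ψ φ = (C.sign 0 : 𝕜) * C.form φ ψ := by
  have key (r : ℤ) (hr : r = 1 ∨ r = -1) (h : ∀ φ ψ, C.form ψ φ = (r : 𝕜) * C.form φ ψ) :=
    C.proj_swap_of_exists (k := 0) hr (by simpa [proj_zero] using h) φ ψ ![]
  simp only [proj_zero] at key
  rcases C.symm_zero with h | h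
  · exact key 1 (by simp) (by simpa using h)
  · exact key (-1) (by simp) (by simpa using h)

theorem form_gammaModel_swap (φ ψ : S₀) (v : V) :
    C.form ψ (gammaModel ρ v φ) = (C.sign 1 : 𝕜) * C.form φ (gammaModel ρ v ψ) := by
  have key (r : ℤ) (hr : r = 1 ∨ r = -1)
      (h : ∀ φ ψ v, C.form ψ (gammaModel ρ v φ) = (r : 𝕜) * C.form φ (gammaModel ρ v ψ)) :=
    C.proj_swap_of_exists (k := 1) hr (fun φ ψ w => by simpa [proj_one] using h φ ψ (w 0)) φ ψ ![v]
  simp only [proj_one] at key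
  rcases C.symm_one with h | h
  · exact key 1 (by simp) (by simpa using h)
  · exact key (-1) (by simp) (by simpa using h)

theorem sign_mul_self (k : ℕ) : (C.sign k : 𝕜) * C.sign k = 1 := by
  rcases C.sign_eq_one_or k with h | h <;> simp [h]

theorem form_gammaModel_left (v : V) (φ ψ : S₀) :
    C.form (gammaModel ρ v φ) ψ =
      ((C.sign 0 : 𝕜) * C.sign 1) * C.form φ (gammaModel ρ v ψ) := by
  rw [C.form_swap ψ, C.form_gammaModel_swap φ ψ, mul_assoc]

theorem proj_swap_explicit (k : ℕ) (φ ψ : S₀) (v : Fin k → V) :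
    C.proj k ψ φ v = ((C.sign 0 * (C.sign 0 * C.sign 1) ^ k * (-1) ^ (k * (k - 1) / 2) : ℤ) : 𝕜) *
      C.proj k φ ψ v := by
  rw [proj, C.form_swap, adjoint_gammaAnti _ _ _ C.form_gammaModel_left, proj]
  push_cast
  ring

/-- The map `C_k` has the symmetry `Δ_k`. -/
theorem proj_swap (k : ℕ) (φ ψ : S₀) (v : Fin k → V) :
    C.proj k ψ φ v = (C.sign k : 𝕜) * C.proj k φ ψ v := by
  refine C.proj_swap_of_exists ?_ (C.proj_swap_explicit k) φ ψ v
  rcases C.sign_eq_one_or 0 with h | h <;> rcases C.sign_eq_one_or 1 with h' | h' <;>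
    rcases neg_one_pow_eq_or ℤ k with e | e <;>
    rcases neg_one_pow_eq_or ℤ (k * (k - 1) / 2) with e' | e' <;> simp [h, h', e, e']

theorem sign_eq_of_gammaAnti_ne_zero {k : ℕ} {v : Fin k → V}
    (hv : gammaAnti (gammaModel ρ) v ≠ 0) :
    C.sign k = C.sign 0 * (C.sign 0 * C.sign 1) ^ k * (-1) ^ (k * (k - 1) / 2) := by
  obtain ⟨ψ, hψ⟩ : ∃ ψ, gammaAnti (gammaModel ρ) v ψ ≠ 0 := by
    by_contra! h
    exact hv (LinearMap.ext h)
  obtain ⟨φ, hφ⟩ : ∃ φ, C.proj k φ ψ v ≠ 0 := by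
    by_contra! h
    refine hψ (C.nondegenerate _ fun φ => ?_)
    rw [C.form_swap φ]
    simpa [proj] using Or.inr (h φ)
  have h := (C.proj_swap k φ ψ v).symm.trans (C.proj_swap_explicit k φ ψ v)
  exact_mod_cast mul_right_cancel₀ hφ h

theorem sign_table {ℓ : ℕ} {v : Fin ℓ → V} (hv : gammaAnti (gammaModel ρ) v ≠ 0) (i j : Fin 4) :
    C.sign ℓ * C.sign 1 * eps j * epsComm i j = -1 ↔ InTable (C.sign 0 * C.sign 1) ℓ i j := by
  rw [← sign_eq_neg_one_iff_inTable, C.sign_eq_of_gammaAnti_ne_zero hv, pow_succ]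
  · ring_nf
  · rcases C.sign_eq_one_or 0 with h | h <;> rcases C.sign_eq_one_or 1 with h' | h' <;>
      simp [h, h']

end ChargeConjugation

end ChargeConjugation

section Geometry

variable {E : Type*} [NormedAddCommGroup E] [NormedSpace ℝ E]
  {H : Type*} [TopologicalSpace H] {I : ModelWithCorners ℝ E H}
  {M : Type*} [TopologicalSpace M] [ChartedSpace H M] [IsManifold I ∞ M]

section Connections

variable {F : Type*} [NormedAddCommGroup F] [NormedSpace ℝ F]
  {W : M → Type*} [TopologicalSpace (TotalSpace F W)]
  [∀ x, AddCommGroup (W x)] [∀ x, Module ℝ (W x)]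
  [∀ x, TopologicalSpace (W x)] [∀ x, IsTopologicalAddGroup (W x)] [∀ x, ContinuousSMul ℝ (W x)]
  [FiberBundle F W] [FiniteDimensional ℝ E]
  {𝕜 : Type*} [RCLike 𝕜] [∀ x, Module 𝕜 (W x)] [∀ x, IsScalarTower ℝ 𝕜 (W x)]

theorem IsChargeDual.addOneForm {B : Π x : M, W x →ₗ[𝕜] W x →ₗ[𝕜] 𝕜}
    {D DC : CovariantDerivative I F W} (h : IsChargeDual B D DC)
    {A A' : Π x : M, TangentSpace I x →ₗ[ℝ] W x →ₗ[ℝ] W x}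
    (hA : ∀ x X φ ψ, B x (A x X φ) ψ + B x φ (A' x X ψ) = 0) :
    IsChargeDual B (addOneForm D A) (addOneForm DC A') := by
  intro x σ τ X hσ hτ
  rw [h x σ τ X hσ hτ, addOneForm_apply, addOneForm_apply, map_add, map_add, LinearMap.add_apply]
  linear_combination -hA x X (σ x) (τ x)

theorem IsChargeDual.unique
    {B : Π x : M, W x →ₗ[𝕜] W x →ₗ[𝕜] 𝕜} (hB : ∀ x ψ, (∀ φ, B x φ ψ = 0) → ψ = 0)
    {D DC DC' : CovariantDerivative I F W} (h : IsChargeDual B D DC) (h' : IsChargeDual B D DC')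
    {x : M} {τ : Π x, W x} (hτ : SectionDiffAt I F τ x) (X : TangentSpace I x) :
    DC' τ x X = DC τ x X := by
  refine sub_eq_zero.1 (hB x _ fun φ => ?_)
  have hσ : SectionDiffAt I F (FiberBundle.extend F φ) x := FiberBundle.mdifferentiableAt_extend ..
  have e := (h x _ τ X hσ hτ).symm.trans (h' x _ τ X hσ hτ)
  rw [FiberBundle.extend_apply_self] at e
  rw [map_sub]
  linear_combination -e

/-- Adding a one-form `A` to an admissible connection preserves admissibility if and only if `A`
satisfies a pointwise skew symmetry condition; `-A'` is the adjoint of `A`. -/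
theorem Admissible.addOneForm_iff
    {nabla : CovariantDerivative I E (TangentSpace I : M → Type _)}
    {γ : Π x : M, TangentSpace I x →ₗ[ℝ] Module.End 𝕜 (W x)}
    {B : Π x : M, W x →ₗ[𝕜] W x →ₗ[𝕜] 𝕜} (hB : ∀ x ψ, (∀ φ, B x φ ψ = 0) → ψ = 0)
    {D : CovariantDerivative I F W} (hD : Admissible nabla γ B D)
    {A A' : Π x : M, TangentSpace I x →ₗ[ℝ] W x →ₗ[ℝ] W x}
    (hA : ∀ x X φ ψ, B x (A x X φ) ψ + B x φ (A' x X ψ) = 0) :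
    Admissible nabla γ B (addOneForm D A) ↔
      ∀ x X Y ξ, (A x X (γ x Y ξ) - γ x Y (A' x X ξ)) +
        (A x Y (γ x X ξ) - γ x X (A' x Y ξ)) = 0 := by
  obtain ⟨DC, hDC, hskew⟩ := hD
  have key (X Y : Π x : M, TangentSpace I x) (ξ : Π x, W x) (x : M) :
      hatD nabla γ (addOneForm D A) (addOneForm DC A') X Y ξ x = hatD nabla γ D DC X Y ξ x +
        (A x (X x) (γ x (Y x) (ξ x)) - γ x (Y x) (A' x (X x) (ξ x))) := by
    simp only [hatD, addOneForm_apply, map_add]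
    abel
  constructor
  · rintro ⟨DC', hDC', hskew'⟩ x X Y ξ
    have hX : SectionDiffAt I E (FiberBundle.extend E X) x := FiberBundle.mdifferentiableAt_extend ..
    have hY : SectionDiffAt I E (FiberBundle.extend E Y) x := FiberBundle.mdifferentiableAt_extend ..
    have hξ : SectionDiffAt I F (FiberBundle.extend F ξ) x := FiberBundle.mdifferentiableAt_extend ..
    have e (X Y : Π x : M, TangentSpace I x) :
        hatD nabla γ (addOneForm D A) DC' X Y (FiberBundle.extend F ξ) x =
        hatD nabla γ (addOneForm D A) (addOneForm DC A') X Y (FiberBundle.extend F ξ) x := by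
      simp only [hatD, (hDC.addOneForm hA).unique hB hDC' hξ]
    have h := hskew' x _ _ _ hX hY hξ
    rw [e, e, key, key, hskew x _ _ _ hX hY hξ] at h
    simp only [FiberBundle.extend_apply_self] at h
    have h0 := add_eq_zero_iff_eq_neg.2 h
    rw [← h0]
    abel
  · intro h
    refine ⟨_, hDC.addOneForm hA, fun x X Y ξ hX hY hξ => ?_⟩
    rw [key, key, hskew x X Y ξ hX hY hξ, eq_neg_iff_add_eq_zero, ← h x (X x) (Y x) (ξ x)]
    abel

end Connections

/-! ### Local frames and parallel tensors -/

section Frames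

variable {F : Type*} [NormedAddCommGroup F] [NormedSpace ℝ F] [FiniteDimensional ℝ F]
  {W : M → Type*} [TopologicalSpace (TotalSpace F W)]
  [∀ x, AddCommGroup (W x)] [∀ x, Module ℝ (W x)] [∀ x, TopologicalSpace (W x)]
  [FiberBundle F W] [VectorBundle ℝ F W]

/-- A section which is differentiable at `x` has differentiable coefficients with respect to a
frame of differentiable sections. -/
theorem exists_frame_coeff {ι : Type} [Fintype ι] {x : M} {s : ι → Π y, W y}
    (hs : ∀ i, SectionDiffAt I F (s i) x) (b : Basis ι ℝ (W x)) (hb : ∀ i, b i = s i x)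
    {σ : Π y, W y} (hσ : SectionDiffAt I F σ x) :
    ∃ c : ι → M → ℝ, (∀ i, MDifferentiableAt I 𝓘(ℝ, ℝ) (c i) x) ∧
      ∀ᶠ y in nhds x, σ y = ∑ i, c i y • s i y := by
  classical
  set t := trivializationAt F W x
  have hx : x ∈ t.baseSet := FiberBundle.mem_baseSet_trivializationAt' x
  let u : (Π y, W y) → M → F := fun τ y => (t (TotalSpace.mk' F y (τ y))).2
  have hu {τ : Π y, W y} (hτ : SectionDiffAt I F τ x) : MDifferentiableAt I 𝓘(ℝ, F) (u τ) x :=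
    (mdifferentiableAt_section I τ).1 hτ
  let L : M → ((ι → ℝ) →L[ℝ] F) := fun y =>
    ∑ i, (ContinuousLinearMap.proj (R := ℝ) (φ := fun _ : ι => ℝ) i).smulRight (u (s i) y)
  have hL : MDifferentiableAt I 𝓘(ℝ, (ι → ℝ) →L[ℝ] F) L x := by
    have h (i : ι) : MDifferentiableAt I 𝓘(ℝ, (ι → ℝ) →L[ℝ] F) (fun y =>
        (ContinuousLinearMap.proj (R := ℝ) (φ := fun _ : ι => ℝ) i).smulRight (u (s i) y)) x :=
      (ContinuousLinearMap.smulRightL ℝ (ι → ℝ) F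
        (ContinuousLinearMap.proj (R := ℝ) (φ := fun _ : ι => ℝ) i)).mdifferentiableAt.comp x
        (hu (hs i))
    have h' : MDifferentiableAt I 𝓘(ℝ, (ι → ℝ) →L[ℝ] F) (∑ i, fun y =>
        (ContinuousLinearMap.proj (R := ℝ) (φ := fun _ : ι => ℝ) i).smulRight (u (s i) y)) x :=
      MDifferentiableAt.sum fun i _ => h i
    convert! h' using 1
    funext y
    simp [L]
  let e₀ : (ι → ℝ) ≃L[ℝ] F :=
    (b.equivFun.symm.trans (t.linearEquivAt ℝ x hx)).toContinuousLinearEquiv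
  have he₀ : (e₀ : (ι → ℝ) →L[ℝ] F) = L x := by
    ext c
    simp [e₀, L, u, Basis.equivFun_symm_apply, hb]
  have hinv : ∀ᶠ y in nhds x, (L y).IsInvertible := by
    have : ∀ᶠ A in nhds (L x), A.IsInvertible := by
      rw [← he₀]
      exact ContinuousLinearEquiv.nhds e₀
    exact hL.continuousAt.eventually this
  have hLinv : MDifferentiableAt I 𝓘(ℝ, F →L[ℝ] (ι → ℝ)) (fun y => (L y).inverse) x := by
    have h : DifferentiableAt ℝ (ContinuousLinearMap.inverse (M := ι → ℝ) (M₂ := F) (R := ℝ))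
        (L x) := by
      rw [← he₀]
      exact (contDiffAt_map_inverse (n := 1) e₀).differentiableAt one_ne_zero
    exact h.mdifferentiableAt.comp x hL
  have hc := hLinv.clm_apply (hu hσ)
  refine ⟨fun i y => (L y).inverse (u σ y) i, fun i => ?_, ?_⟩
  · exact (ContinuousLinearMap.proj (R := ℝ) (φ := fun _ : ι => ℝ) i).mdifferentiableAt.comp x hc
  · filter_upwards [hinv, t.open_baseSet.mem_nhds hx] with y hy hyt
    have h : L y ((L y).inverse (u σ y)) = u σ y := hy.self_apply_inverse _
    apply (t.linearEquivAt ℝ y hyt).injective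
    rw [map_sum]
    simp only [map_smul]
    simpa [L, u] using h.symm

/-- Induction principle for sections which are differentiable at `x`. -/
theorem section_induction {ι : Type} [Fintype ι] {x : M} {s : ι → Π y, W y}
    (hs : ∀ i, SectionDiffAt I F (s i) x) (b : Basis ι ℝ (W x)) (hb : ∀ i, b i = s i x)
    (Q : (Π y, W y) → Prop) (zero : Q 0)
    (add : ∀ σ τ, SectionDiffAt I F σ x → SectionDiffAt I F τ x → Q σ → Q τ → Q (σ + τ))
    (smul : ∀ (c : M → ℝ) (σ : Π y, W y), MDifferentiableAt I 𝓘(ℝ, ℝ) c x →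
      SectionDiffAt I F σ x → Q σ → Q (c • σ))
    (congr : ∀ σ τ, SectionDiffAt I F σ x → SectionDiffAt I F τ x →
      (∀ᶠ y in nhds x, σ y = τ y) → Q σ → Q τ)
    (frame : ∀ i, Q (s i)) {σ : Π y, W y} (hσ : SectionDiffAt I F σ x) : Q σ := by
  classical
  obtain ⟨c, hc, h⟩ := exists_frame_coeff hs b hb hσ
  have key (t : Finset ι) : SectionDiffAt I F (∑ i ∈ t, c i • s i) x ∧ Q (∑ i ∈ t, c i • s i) := by
    induction t using Finset.induction_on with
    | empty => exact ⟨mdifferentiableAt_zeroSection .., zero⟩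
    | insert i t hi ih =>
      rw [Finset.sum_insert hi]
      have h1 : SectionDiffAt I F (c i • s i) x := (hc i).smul_section (hs i)
      exact ⟨mdifferentiableAt_add_section h1 ih.1,
        add _ _ h1 ih.1 (smul _ _ (hc i) (hs i) (frame i)) ih.2⟩
  refine congr _ σ (key Finset.univ).1 hσ ?_ (key Finset.univ).2
  filter_upwards [h] with y hy
  rw [hy]
  simp

end Frames

end Geometry

section Geometry

variable {E : Type*} [NormedAddCommGroup E] [NormedSpace ℝ E]
  {H : Type*} [TopologicalSpace H] {I : ModelWithCorners ℝ E H}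
  {M : Type*} [TopologicalSpace M] [ChartedSpace H M] [IsManifold I ∞ M]
  {𝕜 : Type*} [RCLike 𝕜] {V : Type*} [AddCommGroup V] [Module ℝ V] {η : QuadraticForm ℝ V}
  {S₀ : Type*} [AddCommGroup S₀] [Module ℝ S₀] [Module 𝕜 S₀] [IsScalarTower ℝ 𝕜 S₀]
  {F : Type*} [NormedAddCommGroup F] [NormedSpace ℝ F]
  {g : PseudoRiemannianMetric I M} {ρ : CliffordAlgebra (-η) →ₐ[ℝ] Module.End 𝕜 S₀}

theorem ChargeConjugation.form_spinLieAlgebra_left (C : ChargeConjugation ρ)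
    {a : CliffordAlgebra (-η)} (ha : a ∈ spinLieAlgebra (-η)) (φ ψ : S₀) :
    C.form (ρ a φ) ψ = -C.form φ (ρ a ψ) := by
  induction ha using Submodule.span_induction with
  | mem a ha =>
    obtain ⟨v, w, rfl⟩ := ha
    have h (v w : V) : C.form (ρ (CliffordAlgebra.ι (-η) v) (ρ (CliffordAlgebra.ι (-η) w) φ)) ψ =
        C.form φ (ρ (CliffordAlgebra.ι (-η) w) (ρ (CliffordAlgebra.ι (-η) v) ψ)) := by
      have e1 := C.form_gammaModel_left v (ρ (CliffordAlgebra.ι (-η) w) φ) ψ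
      have e2 := C.form_gammaModel_left w φ (ρ (CliffordAlgebra.ι (-η) v) ψ)
      simp only [gammaModel, LinearMap.comp_apply, AlgHom.toLinearMap_apply] at e1 e2
      rw [e1, e2]
      linear_combination (C.form φ (ρ (CliffordAlgebra.ι (-η) w) (ρ (CliffordAlgebra.ι (-η) v) ψ))) *
        ((C.sign 1 : 𝕜) * C.sign 1 * C.sign_mul_self (𝕜 := 𝕜) 0 + C.sign_mul_self (𝕜 := 𝕜) 1)
    simp [h]
  | zero => simp
  | add a b _ _ ha hb => simp [ha, hb]; ring
  | smul r a _ ha =>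
    rw [map_smul, LinearMap.smul_apply, LinearMap.smul_apply, LinearMap.map_smul_of_tower,
      LinearMap.map_smul_of_tower, LinearMap.smul_apply, ha, smul_neg]

namespace SpinStructure

section Fibre

variable {S : M → Type*} [TopologicalSpace (TotalSpace F S)]
  [∀ x, AddCommGroup (S x)] [∀ x, Module ℝ (S x)] [∀ x, Module 𝕜 (S x)]
  [∀ x, IsScalarTower ℝ 𝕜 (S x)]
  [∀ x, TopologicalSpace (S x)] [FiberBundle F S] [VectorBundle ℝ F S]
  (P : SpinStructure g ρ F S) (C : ChargeConjugation ρ)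

theorem spinFrame_real_smul (p x : M) (r : ℝ) (φ : S₀) :
    P.spinFrame p x (r • φ) = r • P.spinFrame p x φ := by
  rw [← algebraMap_smul 𝕜 r φ, map_smul, algebraMap_smul]

theorem gamma_spinFrame_self (x : M) (X : TangentSpace I x) (φ : S₀) :
    P.gamma x X (P.spinFrame x x φ) =
      P.spinFrame x x (gammaModel ρ ((P.vecFrame x x).symm X) φ) := by
  simp [gamma]

theorem gamma_spinFrame {p x : M} (hx : x ∈ P.domain p) (v : V) (φ : S₀) :
    P.gamma x (P.vecFrame p x v) (P.spinFrame p x φ) = P.spinFrame p x (gammaModel ρ v φ) := by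
  obtain ⟨h, hh, h1, h2⟩ := P.transition x p x ⟨P.mem_domain x, hx⟩
  rw [h2, h2, gamma_spinFrame_self]
  simp only [gammaModel, LinearMap.comp_apply, AlgHom.toLinearMap_apply]
  rw [h1, ← Module.End.mul_apply, ← map_mul, mul_assoc, spinGroup.star_mul_self_of_mem hh, mul_one,
    map_mul, Module.End.mul_apply]

theorem form_spinFrame {p x : M} (hx : x ∈ P.domain p) (φ ψ : S₀) :
    P.form C x (P.spinFrame p x φ) (P.spinFrame p x ψ) = C.form φ ψ := by
  obtain ⟨h, hh, -, h2⟩ := P.transition x p x ⟨P.mem_domain x, hx⟩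
  rw [h2, h2]
  simp [form, C.spin_invariant h hh]

theorem gamma_mul_gamma_add (x : M) (X Y : TangentSpace I x) :
    P.gamma x X * P.gamma x Y + P.gamma x Y * P.gamma x X =
      (-2 * g.bilin x X Y) • (1 : Module.End 𝕜 (S x)) := by
  have hη (X : TangentSpace I x) : η ((P.vecFrame x x).symm X) = g.bilin x X X := by
    rw [← P.vecFrame_isometry x x (P.mem_domain x)]
    simp [PseudoRiemannianMetric.bilin]
  have hsymm : g.bilin x Y X = g.bilin x X Y := g.symm x Y X
  have hpolar : QuadraticMap.polar (-η) ((P.vecFrame x x).symm X) ((P.vecFrame x x).symm Y) =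
      -2 * g.bilin x X Y := by
    simp only [QuadraticMap.polar, QuadraticMap.neg_apply, ← map_add, hη]
    simp only [map_add, LinearMap.add_apply, hsymm]
    ring
  have key := congrArg ρ (CliffordAlgebra.ι_mul_ι_add_swap (Q := -η)
    ((P.vecFrame x x).symm X) ((P.vecFrame x x).symm Y))
  rw [hpolar] at key
  generalize -2 * g.bilin x X Y = r at key ⊢
  refine LinearMap.ext fun φ => ?_
  obtain ⟨φ, rfl⟩ := (P.spinFrame x x).surjective φ
  have key' := LinearMap.congr_fun key φ
  simp only [map_add, map_mul, AlgHom.commutes, LinearMap.add_apply, Module.End.mul_apply] at key'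
  simp only [LinearMap.add_apply, Module.End.mul_apply, gamma_spinFrame_self, ← map_add]
  simp only [gammaModel, LinearMap.comp_apply, AlgHom.toLinearMap_apply]
  rw [key', Algebra.algebraMap_eq_smul_one, LinearMap.smul_apply, LinearMap.smul_apply,
    spinFrame_real_smul]
  rfl

theorem gammaAnti_spinFrame (x : M) {k : ℕ} (v : Fin k → TangentSpace I x) (φ : S₀) :
    gammaAnti (P.gamma x) v (P.spinFrame x x φ) =
      P.spinFrame x x (gammaAnti (gammaModel ρ) (fun a => (P.vecFrame x x).symm (v a)) φ) := by
  have h (L : List (TangentSpace I x)) (φ : S₀) : (L.map (P.gamma x)).prod (P.spinFrame x x φ) =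
      P.spinFrame x x ((L.map fun X => gammaModel ρ ((P.vecFrame x x).symm X)).prod φ) := by
    induction L with
    | nil => simp
    | cons X L ih => simp [ih, gamma_spinFrame_self]
  simp only [gammaAnti, LinearMap.smul_apply, LinearMap.sum_apply, map_smul, map_sum]
  congr 1
  refine Finset.sum_congr rfl fun s _ => ?_
  have h' := h (List.ofFn fun a => v (s a)) φ
  simp only [List.map_ofFn, Function.comp_def] at h'
  rw [h', map_zsmul]

theorem form_gamma_left (x : M) (X : TangentSpace I x) (φ ψ : S x) :
    P.form C x (P.gamma x X φ) ψ =
      ((C.sign 0 : 𝕜) * C.sign 1) * P.form C x φ (P.gamma x X ψ) := by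
  obtain ⟨φ, rfl⟩ := (P.spinFrame x x).surjective φ
  obtain ⟨ψ, rfl⟩ := (P.spinFrame x x).surjective ψ
  simp only [gamma_spinFrame_self, P.form_spinFrame C (P.mem_domain x), C.form_gammaModel_left]

theorem form_gammaAnti_left (x : M) {k : ℕ} (v : Fin k → TangentSpace I x) (φ ψ : S x) :
    P.form C x (gammaAnti (P.gamma x) v φ) ψ =
      ((C.sign 0 : 𝕜) * C.sign k) * P.form C x φ (gammaAnti (P.gamma x) v ψ) := by
  obtain ⟨φ, rfl⟩ := (P.spinFrame x x).surjective φ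
  obtain ⟨ψ, rfl⟩ := (P.spinFrame x x).surjective ψ
  simp only [gammaAnti_spinFrame, P.form_spinFrame C (P.mem_domain x)]
  have h := C.proj_swap k φ ψ (fun a => (P.vecFrame x x).symm (v a))
  rw [ChargeConjugation.proj, ChargeConjugation.proj] at h
  rw [C.form_swap ψ, h, mul_assoc]

theorem form_nondegenerate (x : M) (ψ : S x) (h : ∀ φ, P.form C x φ ψ = 0) : ψ = 0 := by
  obtain ⟨ψ, rfl⟩ := (P.spinFrame x x).surjective ψ
  rw [C.nondegenerate ψ fun φ => ?_, map_zero]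
  rw [C.form_swap φ, ← P.form_spinFrame C (P.mem_domain x), h, mul_zero]

theorem finiteDimensional_spinor [FiniteDimensional ℝ F] (P : SpinStructure g ρ F S) (x : M) : FiniteDimensional ℝ S₀ :=
  Module.Finite.equiv (((P.spinFrame x x).restrictScalars ℝ).trans
    ((trivializationAt F S x).linearEquivAt ℝ x
      (FiberBundle.mem_baseSet_trivializationAt' x))).symm

theorem finiteDimensional_vector [FiniteDimensional ℝ E] (P : SpinStructure g ρ F S) (x : M) : FiniteDimensional ℝ V :=
  have : FiniteDimensional ℝ (TangentSpace I x) := inferInstanceAs (FiniteDimensional ℝ E)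
  Module.Finite.equiv (P.vecFrame x x).symm

end Fibre

section Parallel

variable {S : M → Type*} [TopologicalSpace (TotalSpace F S)]
  [∀ x, AddCommGroup (S x)] [∀ x, Module ℝ (S x)] [∀ x, Module 𝕜 (S x)]
  [∀ x, IsScalarTower ℝ 𝕜 (S x)]
  [∀ x, TopologicalSpace (S x)] [∀ x, IsTopologicalAddGroup (S x)]
  [∀ x, ContinuousSMul ℝ (S x)] [FiberBundle F S] [VectorBundle ℝ F S]
  (P : SpinStructure g ρ F S) (C : ChargeConjugation ρ)

theorem spinFrame_diffAt (x : M) (φ : S₀) :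
    SectionDiffAt I F (fun y => P.spinFrame x y φ) x :=
  ((P.spinFrame_smooth x φ).contMDiffAt ((P.isOpen_domain x).mem_nhds (P.mem_domain x))).mdifferentiableAt
    (by simp)

theorem vecFrame_diffAt (x : M) (v : V) :
    SectionDiffAt I E (fun y => P.vecFrame x y v) x :=
  ((P.vecFrame_smooth x v).contMDiffAt ((P.isOpen_domain x).mem_nhds (P.mem_domain x))).mdifferentiableAt
    (by simp)

theorem spinor_induction [FiniteDimensional ℝ F] (x : M)
    (Q : (Π y, S y) → Prop) (zero : Q 0)
    (add : ∀ σ τ, SectionDiffAt I F σ x → SectionDiffAt I F τ x → Q σ → Q τ → Q (σ + τ))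
    (smul : ∀ (c : M → ℝ) (σ : Π y, S y), MDifferentiableAt I 𝓘(ℝ, ℝ) c x →
      SectionDiffAt I F σ x → Q σ → Q (c • σ))
    (congr : ∀ σ τ, SectionDiffAt I F σ x → SectionDiffAt I F τ x →
      (∀ᶠ y in nhds x, σ y = τ y) → Q σ → Q τ)
    (frame : ∀ φ, Q (fun y => P.spinFrame x y φ)) {σ : Π y, S y} (hσ : SectionDiffAt I F σ x) :
    Q σ := by
  have := P.finiteDimensional_spinor x
  exact section_induction (fun i => P.spinFrame_diffAt x (Module.finBasis ℝ S₀ i))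
    ((Module.finBasis ℝ S₀).map ((P.spinFrame x x).restrictScalars ℝ)) (fun i => by simp)
    Q zero add smul congr (fun i => frame _) hσ

theorem vector_induction [FiniteDimensional ℝ E] (x : M)
    (Q : (Π y : M, TangentSpace I y) → Prop) (zero : Q 0)
    (add : ∀ X Y, SectionDiffAt I E X x → SectionDiffAt I E Y x → Q X → Q Y → Q (X + Y))
    (smul : ∀ (c : M → ℝ) (X : Π y : M, TangentSpace I y), MDifferentiableAt I 𝓘(ℝ, ℝ) c x →
      SectionDiffAt I E X x → Q X → Q (c • X))
    (congr : ∀ X Y, SectionDiffAt I E X x → SectionDiffAt I E Y x →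
      (∀ᶠ y in nhds x, X y = Y y) → Q X → Q Y)
    (frame : ∀ v, Q (fun y => P.vecFrame x y v)) {X : Π y : M, TangentSpace I y}
    (hX : SectionDiffAt I E X x) : Q X := by
  have := P.finiteDimensional_vector x
  exact section_induction (fun i => P.vecFrame_diffAt x (Module.finBasis ℝ V i))
    ((Module.finBasis ℝ V).map (P.vecFrame x x)) (fun i => by simp)
    Q zero add smul congr (fun i => frame _) hX

end Parallel

end SpinStructure

end Geometry

section Geometry

variable {E : Type*} [NormedAddCommGroup E] [NormedSpace ℝ E]
  {H : Type*} [TopologicalSpace H] {I : ModelWithCorners ℝ E H}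
  {M : Type*} [TopologicalSpace M] [ChartedSpace H M] [IsManifold I ∞ M]
  {𝕜 : Type*} [RCLike 𝕜] {V : Type*} [AddCommGroup V] [Module ℝ V] {η : QuadraticForm ℝ V}
  {S₀ : Type*} [AddCommGroup S₀] [Module ℝ S₀] [Module 𝕜 S₀] [IsScalarTower ℝ 𝕜 S₀]
  {F : Type*} [NormedAddCommGroup F] [NormedSpace ℝ F]
  {g : PseudoRiemannianMetric I M} {ρ : CliffordAlgebra (-η) →ₐ[ℝ] Module.End 𝕜 S₀}
  {S : M → Type*} [TopologicalSpace (TotalSpace F S)]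
  [∀ x, AddCommGroup (S x)] [∀ x, Module ℝ (S x)] [∀ x, Module 𝕜 (S x)]
  [∀ x, IsScalarTower ℝ 𝕜 (S x)]
  [∀ x, TopologicalSpace (S x)] [∀ x, IsTopologicalAddGroup (S x)]
  [∀ x, ContinuousSMul ℝ (S x)] [FiberBundle F S] [VectorBundle ℝ F S]

theorem mvfderiv_congr_of_eventuallyEq {G : Type*} [NormedAddCommGroup G] [NormedSpace ℝ G]
    {f f' : M → G} {x : M} (h : f =ᶠ[nhds x] f') : mvfderiv I f x = mvfderiv I f' x := by
  ext X
  exact congrArg (fun L => L X) (h.mfderiv_eq (I := I) (I' := 𝓘(ℝ, G)))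

namespace SpinStructure

variable (P : SpinStructure g ρ F S) (C : ChargeConjugation ρ)

theorem form_swap (x : M) (φ ψ : S x) :
    P.form C x ψ φ = (C.sign 0 : 𝕜) * P.form C x φ ψ :=
  C.form_swap _ _

/-- The charge conjugation is parallel for the induced connection. -/
theorem form_parallel [FiniteDimensional ℝ F]
    {nabla : CovariantDerivative I E (TangentSpace I : M → Type _)}
    {nablaS : CovariantDerivative I F S} (h : P.IsInducedConnection nabla nablaS) {x : M}
    {σ τ : Π y, S y} (hσ : SectionDiffAt I F σ x) (hτ : SectionDiffAt I F τ x) :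
    MDifferentiableAt I 𝓘(ℝ, 𝕜) (fun y => P.form C y (σ y) (τ y)) x ∧
    ∀ X, mvfderiv I (fun y => P.form C y (σ y) (τ y)) x X =
      P.form C x (nablaS σ x X) (τ x) + P.form C x (σ x) (nablaS τ x X) := by
  have hdom := (P.isOpen_domain x).mem_nhds (P.mem_domain x)
  let R : (Π y, S y) → (Π y, S y) → Prop := fun σ τ => MDifferentiableAt I 𝓘(ℝ, 𝕜)
    (fun y => P.form C y (σ y) (τ y)) x ∧ ∀ X, mvfderiv I (fun y => P.form C y (σ y) (τ y)) x X =
      P.form C x (nablaS σ x X) (τ x) + P.form C x (σ x) (nablaS τ x X)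
  have hsymm (σ τ : Π y, S y) (h : R σ τ) : R τ σ := by
    have e : (fun y => P.form C y (τ y) (σ y)) =
        (C.sign 0 : ℝ) • (fun y => P.form C y (σ y) (τ y)) := by
      ext y
      rw [P.form_swap C, Pi.smul_apply, RCLike.real_smul_eq_coe_mul]
      simp
    simp only [R]
    rw [e]
    refine ⟨h.1.const_smul _, fun X => ?_⟩
    have e' : (C.sign 0 : ℝ) • (fun y => P.form C y (σ y) (τ y)) =
      (fun _ : M => (C.sign 0 : ℝ)) • (fun y => P.form C y (σ y) (τ y)) := rfl
    rw [e', mvfderiv_smul mdifferentiableAt_const h.1, P.form_swap C x (σ x),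
      P.form_swap C x _ (τ x)]
    simp [h.2, mvfderiv_const, RCLike.real_smul_eq_coe_mul]
    ring
  have hstep (τ : Π y, S y) (hframe : ∀ φ, R (fun y => P.spinFrame x y φ) τ) (σ : Π y, S y)
      (hσ : SectionDiffAt I F σ x) : R σ τ := by
    refine P.spinor_induction x (R · τ) ?_ ?_ ?_ ?_ hframe hσ
    · refine ⟨by simpa using mdifferentiableAt_const, fun X => ?_⟩
      simp [nablaS.zero, mvfderiv_const]
    · intro σ σ' hσ hσ' h1 h2
      have e : (fun y => P.form C y ((σ + σ') y) (τ y)) =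
          (fun y => P.form C y (σ y) (τ y)) + (fun y => P.form C y (σ' y) (τ y)) := by
        ext y; simp
      simp only [R]
      rw [e]
      refine ⟨h1.1.add h2.1, fun X => ?_⟩
      rw [mvfderiv_add h1.1 h2.1, nablaS.isCovariantDerivativeOnUniv.add hσ hσ']
      simp only [add_apply, h1.2, h2.2, map_add, LinearMap.add_apply,
        Pi.add_apply]
      ring
    · intro c σ hc hσ h1
      have e : (fun y => P.form C y ((c • σ) y) (τ y)) =
          c • (fun y => P.form C y (σ y) (τ y)) := by
        ext y; simp [LinearMap.map_smul_of_tower]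
      simp only [R]
      rw [e]
      refine ⟨hc.smul h1.1, fun X => ?_⟩
      rw [mvfderiv_smul hc h1.1, nablaS.isCovariantDerivativeOnUniv.leibniz hσ hc]
      simp [h1.2, LinearMap.map_smul_of_tower]
      ring
    · intro σ σ' hσ hσ' hev h1
      have e : (fun y => P.form C y (σ y) (τ y)) =ᶠ[nhds x]
          (fun y => P.form C y (σ' y) (τ y)) := by
        filter_upwards [hev] with y hy
        rw [hy]
      refine ⟨h1.1.congr_of_eventuallyEq e.symm, fun X => ?_⟩
      rw [← mvfderiv_congr_of_eventuallyEq e, h1.2,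
        nablaS.isCovariantDerivativeOnUniv.congr_of_eventuallyEq hσ hσ' Filter.univ_mem
        hev, hev.self_of_nhds]
  refine hstep τ (fun φ => hsymm _ _ (hstep _ (fun ψ => ?_) τ hτ)) σ hσ
  have e : (fun y => P.form C y (P.spinFrame x y ψ) (P.spinFrame x y φ)) =ᶠ[nhds x]
      fun _ => C.form ψ φ := by
    filter_upwards [hdom] with y hy
    exact P.form_spinFrame C hy ψ φ
  refine ⟨mdifferentiableAt_const.congr_of_eventuallyEq e, fun X => ?_⟩
  obtain ⟨a, ha, -, hS⟩ := h x x (P.mem_domain x) X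
  rw [mvfderiv_congr_of_eventuallyEq e, hS, hS, P.form_spinFrame C (P.mem_domain x),
    P.form_spinFrame C (P.mem_domain x), C.form_spinLieAlgebra_left ha]
  simp [mvfderiv_const]

theorem gamma_parallel_frame
    {nabla : CovariantDerivative I E (TangentSpace I : M → Type _)}
    {nablaS : CovariantDerivative I F S} (h : P.IsInducedConnection nabla nablaS) {x : M}
    (v : V) (φ : S₀) :
    SectionDiffAt I F (fun y => P.gamma y (P.vecFrame x y v) (P.spinFrame x y φ)) x ∧
    ∀ X, nablaS (fun y => P.gamma y (P.vecFrame x y v) (P.spinFrame x y φ)) x X =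
      P.gamma x (nabla (fun y => P.vecFrame x y v) x X) (P.spinFrame x x φ) +
        P.gamma x (P.vecFrame x x v) (nablaS (fun y => P.spinFrame x y φ) x X) := by
  have hdom := (P.isOpen_domain x).mem_nhds (P.mem_domain x)
  have e : ∀ᶠ y in nhds x, P.spinFrame x y (gammaModel ρ v φ) =
      P.gamma y (P.vecFrame x y v) (P.spinFrame x y φ) := by
    filter_upwards [hdom] with y hy
    exact (P.gamma_spinFrame hy v φ).symm
  have h1 := P.spinFrame_diffAt x (gammaModel ρ v φ)
  have h2 : SectionDiffAt I F (fun y => P.gamma y (P.vecFrame x y v) (P.spinFrame x y φ)) x :=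
    h1.congr_of_eventuallyEq (e.mono fun y hy => by simp [hy])
  refine ⟨h2, fun X => ?_⟩
  obtain ⟨a, ha, hV, hS⟩ := h x x (P.mem_domain x) X
  rw [← nablaS.isCovariantDerivativeOnUniv.congr_of_eventuallyEq h1 h2 Filter.univ_mem e, hS, hS,
    gamma_spinFrame_self, gamma_spinFrame_self, LinearEquiv.symm_apply_apply, ← map_add]
  congr 1
  have key := congrArg (fun b => ρ b φ) (hV v)
  simp only [map_sub, map_mul, LinearMap.sub_apply, Module.End.mul_apply] at key
  simp only [gammaModel, LinearMap.comp_apply, AlgHom.toLinearMap_apply]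
  rw [← key]
  abel

theorem gamma_parallel_vecFrame [FiniteDimensional ℝ F]
    {nabla : CovariantDerivative I E (TangentSpace I : M → Type _)}
    {nablaS : CovariantDerivative I F S} (h : P.IsInducedConnection nabla nablaS) {x : M}
    (v : V) {ξ : Π y, S y} (hξ : SectionDiffAt I F ξ x) :
    SectionDiffAt I F (fun y => P.gamma y (P.vecFrame x y v) (ξ y)) x ∧
    ∀ X, nablaS (fun y => P.gamma y (P.vecFrame x y v) (ξ y)) x X =
      P.gamma x (nabla (fun y => P.vecFrame x y v) x X) (ξ x) +
        P.gamma x (P.vecFrame x x v) (nablaS ξ x X) := by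
  let R : (Π y, S y) → Prop := fun ξ =>
    SectionDiffAt I F (fun y => P.gamma y (P.vecFrame x y v) (ξ y)) x ∧
    ∀ X, nablaS (fun y => P.gamma y (P.vecFrame x y v) (ξ y)) x X =
      P.gamma x (nabla (fun y => P.vecFrame x y v) x X) (ξ x) +
        P.gamma x (P.vecFrame x x v) (nablaS ξ x X)
  refine P.spinor_induction x R ?_ ?_ ?_ ?_ (P.gamma_parallel_frame h v) hξ
  · have e : (fun y => P.gamma y (P.vecFrame x y v) ((0 : Π y, S y) y)) = 0 := by
      ext y; simp
    simp only [R]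
    rw [e]
    exact ⟨mdifferentiableAt_zeroSection .., fun X => by simp [nablaS.zero]⟩
  · intro ξ ξ' hξ hξ' h1 h2
    have e : (fun y => P.gamma y (P.vecFrame x y v) ((ξ + ξ') y)) =
        (fun y => P.gamma y (P.vecFrame x y v) (ξ y)) +
        (fun y => P.gamma y (P.vecFrame x y v) (ξ' y)) := by
      ext y; simp
    simp only [R]
    rw [e]
    refine ⟨mdifferentiableAt_add_section h1.1 h2.1, fun X => ?_⟩
    rw [nablaS.isCovariantDerivativeOnUniv.add h1.1 h2.1,
      nablaS.isCovariantDerivativeOnUniv.add hξ hξ']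
    simp only [add_apply, h1.2, h2.2, map_add, Pi.add_apply]
    abel
  · intro c ξ hc hξ h1
    have e : (fun y => P.gamma y (P.vecFrame x y v) ((c • ξ) y)) =
        c • (fun y => P.gamma y (P.vecFrame x y v) (ξ y)) := by
      ext y; simp
    simp only [R]
    rw [e]
    refine ⟨hc.smul_section h1.1, fun X => ?_⟩
    rw [nablaS.isCovariantDerivativeOnUniv.leibniz h1.1 hc,
      nablaS.isCovariantDerivativeOnUniv.leibniz hξ hc]
    simp [h1.2]
    abel
  · intro ξ ξ' hξ hξ' hev h1
    have e : ∀ᶠ y in nhds x, P.gamma y (P.vecFrame x y v) (ξ y) =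
        P.gamma y (P.vecFrame x y v) (ξ' y) := by
      filter_upwards [hev] with y hy
      rw [hy]
    have h2 : SectionDiffAt I F (fun y => P.gamma y (P.vecFrame x y v) (ξ' y)) x :=
      h1.1.congr_of_eventuallyEq (e.mono fun y hy => by simp [hy])
    refine ⟨h2, fun X => ?_⟩
    rw [← nablaS.isCovariantDerivativeOnUniv.congr_of_eventuallyEq h1.1 h2 Filter.univ_mem e, h1.2,
      nablaS.isCovariantDerivativeOnUniv.congr_of_eventuallyEq hξ hξ' Filter.univ_mem hev,
      hev.self_of_nhds]

/-- Clifford multiplication is parallel for the induced connection. -/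
theorem gamma_parallel [FiniteDimensional ℝ E] [FiniteDimensional ℝ F]
    {nabla : CovariantDerivative I E (TangentSpace I : M → Type _)}
    {nablaS : CovariantDerivative I F S} (h : P.IsInducedConnection nabla nablaS) {x : M}
    {Y : Π y : M, TangentSpace I y} {ξ : Π y, S y} (hY : SectionDiffAt I E Y x)
    (hξ : SectionDiffAt I F ξ x) :
    SectionDiffAt I F (fun y => P.gamma y (Y y) (ξ y)) x ∧
    ∀ X, nablaS (fun y => P.gamma y (Y y) (ξ y)) x X =
      P.gamma x (nabla Y x X) (ξ x) + P.gamma x (Y x) (nablaS ξ x X) := by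
  let R : (Π y : M, TangentSpace I y) → Prop := fun Y =>
    SectionDiffAt I F (fun y => P.gamma y (Y y) (ξ y)) x ∧
    ∀ X, nablaS (fun y => P.gamma y (Y y) (ξ y)) x X =
      P.gamma x (nabla Y x X) (ξ x) + P.gamma x (Y x) (nablaS ξ x X)
  refine P.vector_induction x R ?_ ?_ ?_ ?_ (fun v => P.gamma_parallel_vecFrame h v hξ) hY
  · have e : (fun y => P.gamma y ((0 : Π y : M, TangentSpace I y) y) (ξ y)) = 0 := by
      ext y; simp
    simp only [R]
    rw [e]
    exact ⟨mdifferentiableAt_zeroSection .., fun X => by simp [nablaS.zero, nabla.zero]⟩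
  · intro Y Y' hY hY' h1 h2
    have e : (fun y => P.gamma y ((Y + Y') y) (ξ y)) =
        (fun y => P.gamma y (Y y) (ξ y)) + (fun y => P.gamma y (Y' y) (ξ y)) := by
      ext y; simp
    simp only [R]
    rw [e]
    refine ⟨mdifferentiableAt_add_section h1.1 h2.1, fun X => ?_⟩
    rw [nablaS.isCovariantDerivativeOnUniv.add h1.1 h2.1,
      nabla.isCovariantDerivativeOnUniv.add hY hY']
    simp only [add_apply, h1.2, h2.2, map_add, LinearMap.add_apply,
      Pi.add_apply]
    abel
  · intro c Y hc hY h1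
    have e : (fun y => P.gamma y ((c • Y) y) (ξ y)) = c • (fun y => P.gamma y (Y y) (ξ y)) := by
      ext y; simp
    simp only [R]
    rw [e]
    refine ⟨hc.smul_section h1.1, fun X => ?_⟩
    rw [nablaS.isCovariantDerivativeOnUniv.leibniz h1.1 hc,
      nabla.isCovariantDerivativeOnUniv.leibniz hY hc]
    simp [h1.2]
    abel
  · intro Y Y' hY hY' hev h1
    have e : ∀ᶠ y in nhds x, P.gamma y (Y y) (ξ y) = P.gamma y (Y' y) (ξ y) := by
      filter_upwards [hev] with y hy
      rw [hy]
    have h2 : SectionDiffAt I F (fun y => P.gamma y (Y' y) (ξ y)) x :=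
      h1.1.congr_of_eventuallyEq (e.mono fun y hy => by simp [hy])
    refine ⟨h2, fun X => ?_⟩
    rw [← nablaS.isCovariantDerivativeOnUniv.congr_of_eventuallyEq h1.1 h2 Filter.univ_mem e, h1.2,
      nabla.isCovariantDerivativeOnUniv.congr_of_eventuallyEq hY hY' Filter.univ_mem hev,
      hev.self_of_nhds]

end SpinStructure

end Geometry

section Algebra

variable {𝕜 : Type*} [RCLike 𝕜] {T : Type*} [AddCommGroup T] [Module ℝ T]
  {W : Type*} [AddCommGroup W] [Module 𝕜 W]

theorem exists_alternatingMap_ne_zero (𝕜 : Type*) [RCLike 𝕜] [FiniteDimensional ℝ T] {ℓ : ℕ}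
    (hℓ : ℓ ≤ finrank ℝ T) : ∃ F : T [⋀^Fin ℓ]→ₗ[ℝ] 𝕜, F ≠ 0 := by
  let b := Module.finBasis ℝ T
  let p : T →ₗ[ℝ] (Fin ℓ → ℝ) := LinearMap.pi fun i => b.coord (Fin.castLE hℓ i)
  let G : T [⋀^Fin ℓ]→ₗ[ℝ] ℝ := Matrix.detRowAlternating.compLinearMap p
  refine ⟨(Algebra.linearMap ℝ 𝕜).compAlternatingMap G, fun h => ?_⟩
  have h1 := congrArg (fun F => F fun i => b (Fin.castLE hℓ i)) h
  have hG : G (fun i => b (Fin.castLE hℓ i)) = 1 := by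
    have e : (fun i => p (b (Fin.castLE hℓ i))) = (1 : Matrix (Fin ℓ) (Fin ℓ) ℝ) := by
      ext i k
      simp [p, Finsupp.single_apply, Matrix.one_apply]
    change Matrix.det (fun i => p (b (Fin.castLE hℓ i))) = 1
    rw [e, Matrix.det_one]
  simp [hG] at h1

theorem twist_apply_fst (m : Matrix (Fin 2) (Fin 2) ℤ) (ξ : W × W) :
    (twist (𝕜 := 𝕜) m ξ).1 = (m 0 0 : 𝕜) • ξ.1 + (m 0 1 : 𝕜) • ξ.2 := by
  simp [twist, Int.cast_smul_eq_zsmul]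

theorem twist_apply_snd (m : Matrix (Fin 2) (Fin 2) ℤ) (ξ : W × W) :
    (twist (𝕜 := 𝕜) m ξ).2 = (m 1 0 : 𝕜) • ξ.1 + (m 1 1 : 𝕜) • ξ.2 := by
  simp [twist, Int.cast_smul_eq_zsmul]

theorem twist_mul_apply (m m' : Matrix (Fin 2) (Fin 2) ℤ) (ξ : W × W) :
    twist (𝕜 := 𝕜) (m * m') ξ = twist (𝕜 := 𝕜) m (twist (𝕜 := 𝕜) m' ξ) := by
  apply Prod.ext <;>
    simp only [twist_apply_fst, twist_apply_snd, Matrix.mul_apply, Fin.sum_univ_two] <;>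
    push_cast <;> module

theorem twist_one_apply (ξ : W × W) : twist (𝕜 := 𝕜) 1 ξ = ξ := by
  apply Prod.ext <;> simp [twist_apply_fst, twist_apply_snd]

theorem tau_mul_transpose (j : Fin 4) : tau j * (tau j).transpose = 1 := by
  revert j; decide

theorem transpose_mul_tau (j : Fin 4) : (tau j).transpose * tau j = 1 := by
  revert j; decide

theorem transpose_tau_mul_tau (i j : Fin 4) :
    (tau j).transpose * tau i = (eps j * epsComm i j) • (tau i * tau j) := by
  revert i j; decide

theorem twist_prodMap (Φ : Module.End 𝕜 W) (m : Matrix (Fin 2) (Fin 2) ℤ) (ξ : W × W) :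
    twist (𝕜 := 𝕜) m (Φ ξ.1, Φ ξ.2) =
      (Φ (twist (𝕜 := 𝕜) m ξ).1, Φ (twist (𝕜 := 𝕜) m ξ).2) := by
  apply Prod.ext <;> simp [twist_apply_fst, twist_apply_snd]

theorem tensorTwist_apply (Φ : Module.End 𝕜 W) (m : Matrix (Fin 2) (Fin 2) ℤ) (ξ : W × W) :
    tensorTwist Φ m ξ = (Φ (twist (𝕜 := 𝕜) m ξ).1, Φ (twist (𝕜 := 𝕜) m ξ).2) := rfl

theorem formTwist_apply_twist (C : W →ₗ[𝕜] W →ₗ[𝕜] 𝕜) (m : Matrix (Fin 2) (Fin 2) ℤ)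
    (φ ψ : W × W) : formTwist C m φ ψ =
      C φ.1 (twist (𝕜 := 𝕜) m ψ).1 + C φ.2 (twist (𝕜 := 𝕜) m ψ).2 := rfl

theorem formTwist_apply (C : W →ₗ[𝕜] W →ₗ[𝕜] 𝕜) (m : Matrix (Fin 2) (Fin 2) ℤ)
    (φ ψ : W × W) : formTwist C m φ ψ =
      (m 0 0 * C φ.1 ψ.1 + m 0 1 * C φ.1 ψ.2) + (m 1 0 * C φ.2 ψ.1 + m 1 1 * C φ.2 ψ.2) := by
  simp [formTwist_apply_twist, twist_apply_fst, twist_apply_snd]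

theorem formTwist_nondegenerate {C : W →ₗ[𝕜] W →ₗ[𝕜] 𝕜} (hC : ∀ ψ, (∀ φ, C φ ψ = 0) → ψ = 0)
    (i : Fin 4) (ψ : W × W) (h : ∀ φ, formTwist C (tau i) φ ψ = 0) : ψ = 0 := by
  have h0 : twist (𝕜 := 𝕜) (tau i) ψ = 0 := by
    apply Prod.ext
    · exact hC _ fun φ => by simpa [formTwist_apply_twist] using h (φ, 0)
    · exact hC _ fun φ => by simpa [formTwist_apply_twist] using h (0, φ)
  rw [← twist_one_apply (𝕜 := 𝕜) ψ, ← transpose_mul_tau i, twist_mul_apply, h0, map_zero]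

theorem formTwist_adjoint {C : W →ₗ[𝕜] W →ₗ[𝕜] 𝕜} {Φ Φ' : Module.End 𝕜 W} {c : 𝕜}
    (h : ∀ φ ψ, C (Φ φ) ψ = c * C φ (Φ' ψ)) (i j : Fin 4) (φ ψ : W × W) :
    formTwist C (tau i) (tensorTwist Φ (tau j) φ) ψ =
      c * (eps j * epsComm i j) * formTwist C (tau i) φ (tensorTwist Φ' (tau j) ψ) := by
  have hm (a b : Fin 2) : (tau j 0 a : 𝕜) * tau i 0 b + tau j 1 a * tau i 1 b =
      (eps j * epsComm i j) * (tau i a 0 * tau j 0 b + tau i a 1 * tau j 1 b) := by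
    have e := congrArg (fun A => A a b) (transpose_tau_mul_tau i j)
    simp only [Matrix.mul_apply, Fin.sum_univ_two, Matrix.transpose_apply, Matrix.smul_apply,
      smul_eq_mul] at e
    exact_mod_cast e
  simp only [formTwist_apply, tensorTwist_apply, h, twist_apply_fst, twist_apply_snd, map_add,
    map_smul, LinearMap.add_apply, LinearMap.smul_apply, smul_eq_mul]
  linear_combination (c * C φ.1 (Φ' ψ.1)) * hm 0 0 + (c * C φ.1 (Φ' ψ.2)) * hm 0 1 +
    (c * C φ.2 (Φ' ψ.1)) * hm 1 0 + (c * C φ.2 (Φ' ψ.2)) * hm 1 1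

theorem eps_sign (i j : Fin 4) : eps j * epsComm i j = 1 ∨ eps j * epsComm i j = -1 := by
  revert i j; decide

theorem formEnd_eq_zero_of_gammaAnti [Module ℝ W] [IsScalarTower ℝ 𝕜 W] [FiniteDimensional ℝ T]
    (γ : T →ₗ[ℝ] Module.End 𝕜 W) (B : LinearMap.BilinForm ℝ T) (hB : B.Nondegenerate) {ℓ : ℕ}
    (h : ∀ v : Fin ℓ → T, gammaAnti γ v = 0) (F : T [⋀^Fin ℓ]→ₗ[ℝ] 𝕜) :
    formEnd γ B hB F = 0 := by
  simp [formEnd, h]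

theorem formEnd_adjoint [Module ℝ W] [IsScalarTower ℝ 𝕜 W] [FiniteDimensional ℝ T]
    (γ : T →ₗ[ℝ] Module.End 𝕜 W) (B : LinearMap.BilinForm ℝ T) (hB : B.Nondegenerate) {ℓ : ℕ}
    {C : W →ₗ[𝕜] W →ₗ[𝕜] 𝕜} {c : 𝕜}
    (h : ∀ (v : Fin ℓ → T) φ ψ, C (gammaAnti γ v φ) ψ = c * C φ (gammaAnti γ v ψ))
    (F : T [⋀^Fin ℓ]→ₗ[ℝ] 𝕜) (φ ψ : W) :
    C (formEnd γ B hB F φ) ψ = c * C φ (formEnd γ B hB F ψ) := by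
  simp only [formEnd, LinearMap.smul_apply, LinearMap.sum_apply, map_smul, map_sum, smul_eq_mul, h,
    Finset.mul_sum]
  refine Finset.sum_congr rfl fun f _ => ?_
  ring

end Algebra

section Geometry

variable {E : Type*} [NormedAddCommGroup E] [NormedSpace ℝ E] [FiniteDimensional ℝ E]
  {H : Type*} [TopologicalSpace H] {I : ModelWithCorners ℝ E H}
  {M : Type*} [TopologicalSpace M] [ChartedSpace H M] [IsManifold I ∞ M]
  {𝕜 : Type*} [RCLike 𝕜] {V : Type*} [AddCommGroup V] [Module ℝ V] {η : QuadraticForm ℝ V}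
  {S₀ : Type*} [AddCommGroup S₀] [Module ℝ S₀] [Module 𝕜 S₀] [IsScalarTower ℝ 𝕜 S₀]
  {F : Type*} [NormedAddCommGroup F] [NormedSpace ℝ F]
  {g : PseudoRiemannianMetric I M} {ρ : CliffordAlgebra (-η) →ₐ[ℝ] Module.End 𝕜 S₀}
  {S : M → Type*} [TopologicalSpace (TotalSpace F S)]
  [∀ x, AddCommGroup (S x)] [∀ x, Module ℝ (S x)] [∀ x, Module 𝕜 (S x)]
  [∀ x, IsScalarTower ℝ 𝕜 (S x)]
  [∀ x, TopologicalSpace (S x)] [FiberBundle F S] [VectorBundle ℝ F S]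

theorem SpinStructure.exists_gammaAnti_ne_zero [Nontrivial S₀] (P : SpinStructure g ρ F S) (x : M)
    {ℓ : ℕ} (hℓ : ℓ ≤ finrank ℝ E) : ∃ v : Fin ℓ → V, gammaAnti (gammaModel ρ) v ≠ 0 := by
  have : FiniteDimensional ℝ (TangentSpace I x) := inferInstanceAs (FiniteDimensional ℝ E)
  have : Nontrivial (S x) := (P.spinFrame x x).symm.toEquiv.nontrivial
  obtain ⟨α, hα⟩ : ∃ α : TangentSpace I x [⋀^Fin ℓ]→ₗ[ℝ] 𝕜, α ≠ 0 :=
    exists_alternatingMap_ne_zero (T := E) 𝕜 hℓ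
  by_contra! h
  refine hα (eq_zero_of_formEnd_eq_zero (P.gamma x) (g.bilin x) (g.bilin_nondegenerate x)
    (P.gamma_mul_gamma_add x) α (formEnd_eq_zero_of_gammaAnti _ _ _ (fun v => ?_) α))
  refine LinearMap.ext fun φ => ?_
  obtain ⟨φ, rfl⟩ := (P.spinFrame x x).surjective φ
  rw [P.gammaAnti_spinFrame, h]
  simp

variable [∀ x, IsTopologicalAddGroup (S x)] [∀ x, ContinuousSMul ℝ (S x)]

theorem SectionDiffAt.fst {σ : Π x, (S ×ᵇ S) x} {x : M} (h : SectionDiffAt I (F × F) σ x) :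
    SectionDiffAt I F (fun y => (σ y).1) x := by
  rw [SectionDiffAt, mdifferentiableAt_section] at h ⊢
  exact (ContinuousLinearMap.fst ℝ F F).mdifferentiableAt.comp x h

theorem SectionDiffAt.snd {σ : Π x, (S ×ᵇ S) x} {x : M} (h : SectionDiffAt I (F × F) σ x) :
    SectionDiffAt I F (fun y => (σ y).2) x := by
  rw [SectionDiffAt, mdifferentiableAt_section] at h ⊢
  exact (ContinuousLinearMap.snd ℝ F F).mdifferentiableAt.comp x h

theorem mdifferentiableAt_intCast_mul {f : M → 𝕜} {x : M}
    (hf : MDifferentiableAt I 𝓘(ℝ, 𝕜) f x) (r : ℤ) :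
    MDifferentiableAt I 𝓘(ℝ, 𝕜) (fun y => (r : 𝕜) * f y) x := by
  have e : (fun y => (r : 𝕜) * f y) = (r : ℝ) • f := by
    ext y; simp [RCLike.real_smul_eq_coe_mul]
  rw [e]
  exact hf.const_smul _

theorem mvfderiv_intCast_mul {f : M → 𝕜} {x : M}
    (hf : MDifferentiableAt I 𝓘(ℝ, 𝕜) f x) (r : ℤ) (X : TangentSpace I x) :
    mvfderiv I (fun y => (r : 𝕜) * f y) x X = r * mvfderiv I f x X := by
  have e : (fun y => (r : 𝕜) * f y) = (fun _ : M => (r : ℝ)) • f := by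
    ext y; simp [RCLike.real_smul_eq_coe_mul]
  rw [e, mvfderiv_smul mdifferentiableAt_const hf]
  simp [mvfderiv_const, RCLike.real_smul_eq_coe_mul]

theorem mvfderiv_matrix_sum (m : Matrix (Fin 2) (Fin 2) ℤ) {f₁₁ f₁₂ f₂₁ f₂₂ : M → 𝕜} {x : M}
    (d11 : MDifferentiableAt I 𝓘(ℝ, 𝕜) f₁₁ x) (d12 : MDifferentiableAt I 𝓘(ℝ, 𝕜) f₁₂ x)
    (d21 : MDifferentiableAt I 𝓘(ℝ, 𝕜) f₂₁ x) (d22 : MDifferentiableAt I 𝓘(ℝ, 𝕜) f₂₂ x)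
    (X : TangentSpace I x) :
    mvfderiv I (fun y => ((m 0 0 : 𝕜) * f₁₁ y + m 0 1 * f₁₂ y) +
      (m 1 0 * f₂₁ y + m 1 1 * f₂₂ y)) x X =
      (m 0 0 * mvfderiv I f₁₁ x X + m 0 1 * mvfderiv I f₁₂ x X) +
      (m 1 0 * mvfderiv I f₂₁ x X + m 1 1 * mvfderiv I f₂₂ x X) := by
  have c11 := mdifferentiableAt_intCast_mul d11 (m 0 0)
  have c12 := mdifferentiableAt_intCast_mul d12 (m 0 1)
  have c21 := mdifferentiableAt_intCast_mul d21 (m 1 0)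
  have c22 := mdifferentiableAt_intCast_mul d22 (m 1 1)
  rw [← mvfderiv_intCast_mul d11, ← mvfderiv_intCast_mul d12, ← mvfderiv_intCast_mul d21,
    ← mvfderiv_intCast_mul d22, ← add_apply, ← add_apply, ← mvfderiv_add c11 c12,
    ← mvfderiv_add c21 c22, ← add_apply, ← mvfderiv_add (c11.add c12) (c21.add c22)]
  rfl

/-- The connection induced by the Levi-Civita connection on `S ⊕ S` is admissible. -/
theorem SpinStructure.twistedAdmissible_directSum [FiniteDimensional ℝ F]
    (P : SpinStructure g ρ F S) (C : ChargeConjugation ρ)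
    {nabla : CovariantDerivative I E (TangentSpace I : M → Type _)}
    {nablaS : CovariantDerivative I F S} (h : P.IsInducedConnection nabla nablaS) (i : Fin 4) :
    TwistedAdmissible P C nabla i (directSum nablaS nablaS) := by
  refine ⟨directSum nablaS nablaS, fun x σ τ X hσ hτ => ?_, fun x X Y ξ hX hY hξ => ?_⟩
  · obtain ⟨d11, e11⟩ := P.form_parallel C h hσ.fst hτ.fst
    obtain ⟨d12, e12⟩ := P.form_parallel C h hσ.fst hτ.snd
    obtain ⟨d21, e21⟩ := P.form_parallel C h hσ.snd hτ.fst
    obtain ⟨d22, e22⟩ := P.form_parallel C h hσ.snd hτ.snd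
    simp only [formTwist_apply]
    refine (mvfderiv_matrix_sum (tau i) d11 d12 d21 d22 X).trans ?_
    rw [e11, e12, e21, e22]
    simp only [directSum, ContinuousLinearMap.prod_apply]
    ring
  · have key (X Y : Π x : M, TangentSpace I x) (hY : SectionDiffAt I E Y x) :
        hatD nabla (fun x => gammaDouble (P.gamma x)) (directSum nablaS nablaS)
          (directSum nablaS nablaS) X Y ξ x = 0 := by
      apply Prod.ext
      · change nablaS (fun y => P.gamma y (Y y) (ξ y).1) x (X x) -
          P.gamma x (nabla Y x (X x)) (ξ x).1 -
          P.gamma x (Y x) (nablaS (fun y => (ξ y).1) x (X x)) = 0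
        rw [(P.gamma_parallel h hY hξ.fst).2]
        abel
      · change nablaS (fun y => P.gamma y (Y y) (ξ y).2) x (X x) -
          P.gamma x (nabla Y x (X x)) (ξ x).2 -
          P.gamma x (Y x) (nablaS (fun y => (ξ y).2) x (X x)) = 0
        rw [(P.gamma_parallel h hY hξ.snd).2]
        abel
    rw [key X Y hY, key Y X hX, neg_zero]

end Geometry

section Geometry

variable {E : Type*} [NormedAddCommGroup E] [NormedSpace ℝ E] [FiniteDimensional ℝ E]
  {H : Type*} [TopologicalSpace H] {I : ModelWithCorners ℝ E H}
  {M : Type*} [TopologicalSpace M] [ChartedSpace H M] [IsManifold I ∞ M]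
  {𝕜 : Type*} [RCLike 𝕜] {V : Type*} [AddCommGroup V] [Module ℝ V] {η : QuadraticForm ℝ V}
  {S₀ : Type*} [AddCommGroup S₀] [Module ℝ S₀] [Module 𝕜 S₀] [IsScalarTower ℝ 𝕜 S₀]
  {F : Type*} [NormedAddCommGroup F] [NormedSpace ℝ F]
  {g : PseudoRiemannianMetric I M} {ρ : CliffordAlgebra (-η) →ₐ[ℝ] Module.End 𝕜 S₀}
  {S : M → Type*} [TopologicalSpace (TotalSpace F S)]
  [∀ x, AddCommGroup (S x)] [∀ x, Module ℝ (S x)] [∀ x, Module 𝕜 (S x)]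
  [∀ x, IsScalarTower ℝ 𝕜 (S x)]
  [∀ x, TopologicalSpace (S x)] [FiberBundle F S] [VectorBundle ℝ F S]

/-- The endomorphism `(1/ℓ!) F_{i₁ ⋯ i_ℓ} γ^{i₁ ⋯ i_ℓ}` of `S_x`. -/
def SpinStructure.cliffordForm (P : SpinStructure g ρ F S) {ℓ : ℕ} (x : M)
    (α : TangentSpace I x [⋀^Fin ℓ]→ₗ[ℝ] 𝕜) : Module.End 𝕜 (S x) :=
  have : FiniteDimensional ℝ (TangentSpace I x) := inferInstanceAs (FiniteDimensional ℝ E)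
  formEnd (P.gamma x) (g.bilin x) (g.bilin_nondegenerate x) α

theorem contribution_apply (P : SpinStructure g ρ F S) {ℓ : ℕ}
    (α : Π x : M, TangentSpace I x [⋀^Fin ℓ]→ₗ[ℝ] 𝕜) (j : Fin 4) (x : M) (X : TangentSpace I x)
    (ξ : (S ×ᵇ S) x) : contribution P α j x X ξ =
      tensorTwist (P.cliffordForm x (α x) * P.gamma x X) (tau j) ξ := rfl

/-- The `End(S ⊕ S)`-valued one-form `X ↦ s γ(X) (1/ℓ!) F_{i₁ ⋯ i_ℓ} γ^{i₁ ⋯ i_ℓ} ⊗ τ_j`. -/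
def reversedContribution (P : SpinStructure g ρ F S) {ℓ : ℕ}
    (α : Π x : M, TangentSpace I x [⋀^Fin ℓ]→ₗ[ℝ] 𝕜) (j : Fin 4) (s : 𝕜) (x : M) :
    TangentSpace I x →ₗ[ℝ] (S ×ᵇ S) x →ₗ[ℝ] (S ×ᵇ S) x :=
  LinearMap.mk₂ ℝ
    (fun X ξ => s • tensorTwist (P.gamma x X * P.cliffordForm x (α x)) (tau j) ξ)
    (by intro X Y ξ; ext <;> simp [tensorTwist])
    (by intro r X ξ; ext <;> simp [tensorTwist, smul_comm r s])
    (by intro X ξ ζ; simp)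
    (by
      intro r X ξ
      rw [← algebraMap_smul 𝕜 r ξ, map_smul, smul_comm, algebraMap_smul])

theorem reversedContribution_apply (P : SpinStructure g ρ F S) {ℓ : ℕ}
    (α : Π x : M, TangentSpace I x [⋀^Fin ℓ]→ₗ[ℝ] 𝕜) (j : Fin 4) (s : 𝕜) (x : M)
    (X : TangentSpace I x) (ξ : (S ×ᵇ S) x) : reversedContribution P α j s x X ξ =
      s • tensorTwist (P.gamma x X * P.cliffordForm x (α x)) (tau j) ξ := rfl

namespace SpinStructure

variable (P : SpinStructure g ρ F S) (C : ChargeConjugation ρ)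

theorem cliffordForm_ne_zero [Nontrivial S₀] {ℓ : ℕ} {x : M}
    {α : TangentSpace I x [⋀^Fin ℓ]→ₗ[ℝ] 𝕜} (hα : α ≠ 0) : P.cliffordForm x α ≠ 0 := by
  have : FiniteDimensional ℝ (TangentSpace I x) := inferInstanceAs (FiniteDimensional ℝ E)
  have : Nontrivial (S x) := (P.spinFrame x x).symm.toEquiv.nontrivial
  exact fun h => hα (eq_zero_of_formEnd_eq_zero (P.gamma x) (g.bilin x) (g.bilin_nondegenerate x)
    (P.gamma_mul_gamma_add x) α h)

theorem form_cliffordForm_gamma_left {ℓ : ℕ} (x : M) (α : TangentSpace I x [⋀^Fin ℓ]→ₗ[ℝ] 𝕜)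
    (X : TangentSpace I x) (φ ψ : S x) :
    P.form C x ((P.cliffordForm x α * P.gamma x X) φ) ψ =
      ((C.sign ℓ : 𝕜) * C.sign 1) * P.form C x φ ((P.gamma x X * P.cliffordForm x α) ψ) := by
  have : FiniteDimensional ℝ (TangentSpace I x) := inferInstanceAs (FiniteDimensional ℝ E)
  have h (φ ψ : S x) : P.form C x (P.cliffordForm x α φ) ψ =
      ((C.sign 0 : 𝕜) * C.sign ℓ) * P.form C x φ (P.cliffordForm x α ψ) :=
    formEnd_adjoint (P.gamma x) (g.bilin x) (g.bilin_nondegenerate x)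
      (fun v => P.form_gammaAnti_left C x v) α φ ψ
  rw [Module.End.mul_apply, Module.End.mul_apply, h, P.form_gamma_left]
  linear_combination (C.sign ℓ : 𝕜) * C.sign 1 * P.form C x φ
    (P.gamma x X (P.cliffordForm x α ψ)) *
    C.sign_mul_self (𝕜 := 𝕜) 0

theorem contribution_adjoint {ℓ : ℕ} (α : Π x : M, TangentSpace I x [⋀^Fin ℓ]→ₗ[ℝ] 𝕜)
    (i j : Fin 4) (x : M) (X : TangentSpace I x) (φ ψ : (S ×ᵇ S) x) :
    formTwist (P.form C x) (tau i) (contribution P α j x X φ) ψ +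
      formTwist (P.form C x) (tau i) φ (reversedContribution P α j
        (-((C.sign ℓ * C.sign 1 * eps j * epsComm i j : ℤ) : 𝕜)) x X ψ) = 0 := by
  rw [contribution_apply, reversedContribution_apply,
    formTwist_adjoint (P.form_cliffordForm_gamma_left C x (α x) X) i j, map_smul, smul_eq_mul]
  push_cast
  ring

theorem symmetrized_contribution {ℓ : ℕ} (α : Π x : M, TangentSpace I x [⋀^Fin ℓ]→ₗ[ℝ] 𝕜)
    (j : Fin 4) (s : 𝕜) (x : M) (X Y : TangentSpace I x) (ξ : (S ×ᵇ S) x) :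
    (contribution P α j x X (gammaDouble (P.gamma x) Y ξ) -
        gammaDouble (P.gamma x) Y (reversedContribution P α j (-s) x X ξ)) +
      (contribution P α j x Y (gammaDouble (P.gamma x) X ξ) -
        gammaDouble (P.gamma x) X (reversedContribution P α j (-s) x Y ξ)) =
      (-2 * g.bilin x X Y) • (1 + s) • tensorTwist (P.cliffordForm x (α x)) (tau j) ξ := by
  have hγ (φ : S x) : P.gamma x X (P.gamma x Y φ) + P.gamma x Y (P.gamma x X φ) =
      (-2 * g.bilin x X Y) • φ := LinearMap.congr_fun (P.gamma_mul_gamma_add x X Y) φ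
  have hd (Z : TangentSpace I x) (ζ : (S ×ᵇ S) x) :
      gammaDouble (P.gamma x) Z ζ = (P.gamma x Z ζ.1, P.gamma x Z ζ.2) := rfl
  have hΦ (r : ℝ) (φ : S x) : P.cliffordForm x (α x) (r • φ) = r • P.cliffordForm x (α x) φ :=
    LinearMap.map_smul_of_tower _ _ _
  generalize -2 * g.bilin x X Y = r at hγ ⊢
  have key (φ : S x) :
      (P.cliffordForm x (α x) (P.gamma x X (P.gamma x Y φ)) -
        P.gamma x Y ((-s) • P.gamma x X (P.cliffordForm x (α x) φ))) +
      (P.cliffordForm x (α x) (P.gamma x Y (P.gamma x X φ)) -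
        P.gamma x X ((-s) • P.gamma x Y (P.cliffordForm x (α x) φ))) =
      r • (1 + s) • P.cliffordForm x (α x) φ := by
    have e1 := congrArg (P.cliffordForm x (α x)) (hγ φ)
    have e2 := congrArg (s • ·) (hγ (P.cliffordForm x (α x) φ))
    simp only [map_add, hΦ, smul_add] at e1 e2
    rw [add_smul, one_smul, smul_add, ← e1, smul_comm r s, ← e2]
    simp only [map_smul]
    module
  simp only [contribution_apply, reversedContribution_apply, hd, tensorTwist_apply, twist_prodMap]
  exact Prod.ext (key _) (key _)

theorem twistedAdmissible_addOneForm_iff [Nontrivial S₀] (hdim : 0 < finrank ℝ E)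
    [∀ x, IsTopologicalAddGroup (S x)] [∀ x, ContinuousSMul ℝ (S x)]
    {nabla : CovariantDerivative I E (TangentSpace I : M → Type _)} {ℓ : ℕ}
    {α : Π x : M, TangentSpace I x [⋀^Fin ℓ]→ₗ[ℝ] 𝕜} (hα : α ≠ 0) (i j : Fin 4)
    {D : CovariantDerivative I (F × F) (S ×ᵇ S)} (hD : TwistedAdmissible P C nabla i D) :
    TwistedAdmissible P C nabla i (addOneForm D (contribution P α j)) ↔
      C.sign ℓ * C.sign 1 * eps j * epsComm i j = -1 := by
  have hs : C.sign ℓ * C.sign 1 * eps j * epsComm i j = 1 ∨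
      C.sign ℓ * C.sign 1 * eps j * epsComm i j = -1 := by
    rw [mul_assoc]
    rcases C.sign_eq_one_or ℓ with h | h <;> rcases C.sign_eq_one_or 1 with h' | h' <;>
      rcases eps_sign i j with e | e <;> simp [h, h', e]
  have hiff := Admissible.addOneForm_iff
    (fun x => formTwist_nondegenerate (P.form_nondegenerate C x) i) hD
    (P.contribution_adjoint C α i j)
  refine hiff.trans ⟨fun h => hs.resolve_left fun h1 => ?_, fun h x X Y ξ => ?_⟩
  · obtain ⟨x, hx⟩ := Function.ne_iff.1 hα
    obtain ⟨w, hw⟩ : ∃ w, P.cliffordForm x (α x) w ≠ 0 := by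
      by_contra! h0
      exact P.cliffordForm_ne_zero hx (LinearMap.ext h0)
    have : Nontrivial E := Module.nontrivial_of_finrank_pos hdim
    have : Nontrivial (TangentSpace I x) := inferInstanceAs (Nontrivial E)
    obtain ⟨X, hX⟩ := exists_ne (0 : TangentSpace I x)
    obtain ⟨Y, hY⟩ : ∃ Y, g.bilin x X Y ≠ 0 := by
      by_contra! h0
      exact hX (g.nondegenerate x X h0)
    have e := h x X Y (twist (𝕜 := 𝕜) (tau j).transpose (w, 0))
    rw [symmetrized_contribution, h1, tensorTwist_apply, ← twist_mul_apply, tau_mul_transpose,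
      twist_one_apply] at e
    have e1 : (-2 * g.bilin x X Y) • (1 + ((1 : ℤ) : 𝕜)) • P.cliffordForm x (α x) w = 0 :=
      congrArg Prod.fst e
    have h2 : (1 + ((1 : ℤ) : 𝕜)) ≠ 0 := by
      rw [Int.cast_one]
      norm_num
    rcases smul_eq_zero.1 e1 with e1 | e1
    · exact hY (by simpa using e1)
    · exact hw ((smul_eq_zero.1 e1).resolve_left h2)
  · rw [symmetrized_contribution, h]
    simp

end SpinStructure

end Geometry

end SpinorConnection

end

open SpinorConnection in
theorem theorem4p10
    {𝕜 : Type*} [RCLike 𝕜]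
    {E : Type*} [NormedAddCommGroup E] [NormedSpace ℝ E] [FiniteDimensional ℝ E]
    (hdim : 0 < Module.finrank ℝ E)
    {H : Type*} [TopologicalSpace H] {I : ModelWithCorners ℝ E H}
    {M : Type*} [TopologicalSpace M] [ChartedSpace H M] [IsManifold I ∞ M] [Nonempty M]
    (g : PseudoRiemannianMetric I M)
    {V : Type*} [AddCommGroup V] [Module ℝ V] {η : QuadraticForm ℝ V}
    {S₀ : Type*} [AddCommGroup S₀] [Module ℝ S₀] [Module 𝕜 S₀] [IsScalarTower ℝ 𝕜 S₀]
    [Nontrivial S₀]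
    {ρ : CliffordAlgebra (-η) →ₐ[ℝ] Module.End 𝕜 S₀}
    {F : Type*} [NormedAddCommGroup F] [NormedSpace ℝ F] [FiniteDimensional ℝ F]
    {S : M → Type*} [TopologicalSpace (TotalSpace F S)]
    [∀ x, AddCommGroup (S x)] [∀ x, Module ℝ (S x)] [∀ x, Module 𝕜 (S x)]
    [∀ x, IsScalarTower ℝ 𝕜 (S x)]
    [∀ x, TopologicalSpace (S x)] [∀ x, IsTopologicalAddGroup (S x)]
    [∀ x, ContinuousSMul ℝ (S x)] [FiberBundle F S] [VectorBundle ℝ F S]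
    [ContMDiffVectorBundle ∞ F S I]
    (P : SpinStructure g ρ F S) (C : ChargeConjugation ρ)
    (nabla : CovariantDerivative I E (TangentSpace I : M → Type _))
    (hnabla : IsLeviCivita g nabla)
    (nablaS : CovariantDerivative I F S) (hnablaS : P.IsInducedConnection nabla nablaS) :
    (∀ (k : ℕ) (φ ψ : S₀) (v : Fin k → V),
      C.proj k ψ φ v = (C.sign k : 𝕜) * C.proj k φ ψ v) ∧
    (∀ (ℓ : ℕ) (α : Π x : M, TangentSpace I x [⋀^Fin ℓ]→ₗ[ℝ] 𝕜) (i j : Fin 4), α ≠ 0 →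
      (TwistedAdmissible P C nabla i
          (addOneForm (directSum nablaS nablaS) (contribution P α j)) ↔
        C.sign ℓ * C.sign 1 * eps j * epsComm i j = -1) ∧
      ∀ D : CovariantDerivative I (F × F) (S ×ᵇ S), TwistedAdmissible P C nabla i D →
        (TwistedAdmissible P C nabla i (addOneForm D (contribution P α j)) ↔
          C.sign ℓ * C.sign 1 * eps j * epsComm i j = -1)) ∧
    (∀ (ℓ : ℕ) (i j : Fin 4), ℓ ≤ Module.finrank ℝ E →
      (C.sign ℓ * C.sign 1 * eps j * epsComm i j = -1 ↔
        InTable (C.sign 0 * C.sign 1) ℓ i j)) := by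
  obtain ⟨x⟩ := ‹Nonempty M›
  refine ⟨fun k φ ψ v => C.proj_swap k φ ψ v, fun ℓ α i j hα => ?_, fun ℓ i j hℓ => ?_⟩
  · exact ⟨P.twistedAdmissible_addOneForm_iff C hdim hα i j
        (P.twistedAdmissible_directSum C hnablaS i),
      fun D hD => P.twistedAdmissible_addOneForm_iff C hdim hα i j hD⟩
  · obtain ⟨v, hv⟩ := P.exists_gammaAnti_ne_zero x hℓ
    exact C.sign_table hv i j
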